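/- **Setting.** There are $n\ge 1$ agents; the state is $x\in\mathbb R^n$. $G=[g_{ij}]$ and $\widetilde G=[\tilde g_{ij}]$ are symmetric $n\times n$ matrices with zero diagonal and entries in $[0,1]$ (in particular, adjacency matrices of graphs), $\beta\ge 0$, $\sigma>0$ and $\mu\in\mathbb R^n$. If actions $a\in\mathbb R^n$ are taken, agent $i$ obtains $u_i(a,x)=-(a_i-x_i)^2-\beta\sum_j g_{ij}(a_i-a_j)^2$ and the principal obtains $v(a,x)=-\sum_i(a_i-x_i)^2-\beta\sum_{i,j}\tilde g_{ij}(a_i-a_j)^2$. A public signal is a Markov kernel $\varphi$ from $\mathbb R^n$ to a measurable space $M$. After a realization $m$ is publicly observed, the agents play a Nash equilibrium $a^*(m)$ of the game with payoffs $\mathbb E[u_i(a,x)\mid m]$. A signal is *optimal* if it maximizes $\mathbb E[v(a^*(m),x)]$ among all public signals with all measurable spaces of realizations. A signal *informs the agents of* $y(x)$ if $\mathbb E[y(x)\mid m]=y(x)$ almost surely. Let $L,\widetilde L$ be the Laplacian matrices of $G,\widetilde G$ (degree matrix minus weight matrix), $B=(I+\beta L)^{-1}$ and $V=B'(I-2\beta(\widetilde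 L-L))B$. Let $\mathbf 1$ be the vector of ones. **Proposition.** Let $x\sim N(\mu,\Sigma)$ with $\Sigma=\Sigma_\rho=\sigma^2[(1-\rho)I+\rho\mathbf 1\mathbf 1']$, where $\rho\in(-1,1)$ is such that $\Sigma_\rho$ is positive definite (*admissible* $\rho$; for $n\ge 2$ this means $-1/(n-1)<\rho<1$). Then the optimal signal does not depend on $\rho$, and the eigenvectors of $V$ are eigenvectors of $\Sigma^{1/2}V\Sigma^{1/2}$ with eigenvalues of the same sign. Precisely: 1. $V$ has an orthonormal basis of eigenvectors one of which is a multiple of $\mathbf 1$ (the others are then orthogonal to $\mathbf 1$). 2. For every admissible $\rho$, every eigenvector $q$ of $V$, say $Vq=\omega q$, such that $\omega\neq 1$, or $q$ is a multiple of $\mathbf 1$, or $q$ is orthogonal to $\mathbf 1$, is an eigenvector of $\Sigma^{1/2}V\Sigma^{1/2}$ with an eigenvalue of the same sign ($+$, $0$ or $-$) as $\omega$. In particular this holds for every vector of a basis as in 1. 3. For every orthonormal basis $q_1,\dots,q_n$ of eigenvectors of $V$, with eigenvalues $\omega_1,\dots,\omega_n$, the one signal that discloses the statistics $q_j'x$ for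 all $j$ with $\omega_j\ge 0$ is optimal for every admissible $\rho$. 4. For every admissible $\rho$ and every orthonormal basis $z_1,\dots,z_n$ of eigenvectors of $\Sigma^{1/2}V\Sigma^{1/2}$, with eigenvalues $\tau_1,\dots,\tau_n$, the signal that discloses $z_j'\Sigma^{-1/2}x$ for all $j$ with $\tau_j\ge 0$ is optimal, and it conveys the same information (generates the same $\sigma$-algebra on $\mathbb R^n$) as the signal in 3. 5. For every finite list $w_1,\dots,w_k\in\mathbb R^n$, the signal that discloses $w_1'x,\dots,w_k'x$ is either optimal for every admissible $\rho$ or for none. 6. With $q_j,\omega_j$ as in 3, for every admissible $\rho$, every signal $\varphi$ that is optimal for $\rho$, and every $j$ with $\omega_j\ne 0$: $\varphi$ informs the agents of $q_j'x$ if and only if $\omega_j>0$. -/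

import Mathlib

open MeasureTheory ProbabilityTheory Matrix
open scoped MatrixOrder RealInnerProductSpace

universe u v

noncomputable section

/-- State vectors `x ∈ ℝⁿ`. -/
abbrev StateSpace (n : ℕ) : Type := EuclideanSpace ℝ (Fin n)

/-- A weighted undirected graph on the agents: a symmetric matrix with zero diagonal and entries in
`[0, 1]`; graphs in the ordinary sense have all entries in `{0, 1}`. -/
structure IsWeightedGraph {n : ℕ} (g : Matrix (Fin n) (Fin n) ℝ) : Prop where
  symm : g.IsSymm
  diag : ∀ i, g i i = 0
  mem_Icc : ∀ i j, g i j ∈ Set.Icc (0 : ℝ) 1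

/-- Payoff `-(aᵢ - xᵢ)² - β ∑ⱼ gᵢⱼ (aᵢ - aⱼ)²` of agent `i`. -/
def agentPayoff {n : ℕ} (β : ℝ) (g : Matrix (Fin n) (Fin n) ℝ) (i : Fin n)
    (a : Fin n → ℝ) (x : StateSpace n) : ℝ :=
  -(a i - x i) ^ 2 - β * ∑ j, g i j * (a i - a j) ^ 2

/-- Payoff `-∑ᵢ (aᵢ - xᵢ)² - β ∑ᵢ ∑ⱼ g̃ᵢⱼ (aᵢ - aⱼ)²` of the principal. -/
def principalPayoff {n : ℕ} (β : ℝ) (gt : Matrix (Fin n) (Fin n) ℝ)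
    (a : Fin n → ℝ) (x : StateSpace n) : ℝ :=
  -(∑ i, (a i - x i) ^ 2) - β * ∑ i, ∑ j, gt i j * (a i - a j) ^ 2

/-- `α` is a Nash equilibrium of the game among the agents, when the state has law `P` and all
agents observe the realization `m` of the public signal `φ`: for almost every `m`, the action
`α m i` of each agent `i` maximizes the expected payoff of `i` under the common posterior given `m`,
the actions of the others being fixed. -/
def IsEquilibrium {n : ℕ} (β : ℝ) (g : Matrix (Fin n) (Fin n) ℝ)
    (P : Measure (StateSpace n)) [IsProbabilityMeasure P]
    {M : Type u} [MeasurableSpace M] (φ : Kernel (StateSpace n) M) [IsMarkovKernel φ]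
    (α : M → Fin n → ℝ) : Prop :=
  Measurable α ∧ ∀ᵐ m ∂(φ ∘ₘ P), ∀ (i : Fin n) (d : ℝ),
    ∫ x, agentPayoff β g i (Function.update (α m) i d) x ∂(posterior φ P m) ≤
      ∫ x, agentPayoff β g i (α m) x ∂(posterior φ P m)

/-- Expected payoff of the principal from the signal `φ` when the agents play `α`. -/
def principalValue {n : ℕ} (β : ℝ) (gt : Matrix (Fin n) (Fin n) ℝ)
    (P : Measure (StateSpace n))
    {M : Type u} [MeasurableSpace M] (φ : Kernel (StateSpace n) M)
    (α : M → Fin n → ℝ) : ℝ :=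
  ∫ p, principalPayoff β gt (α p.2) p.1 ∂(P ⊗ₘ φ)

/-- The public signal `φ` is optimal under the state distribution `P`: it gives the principal, in
equilibrium, at least the expected payoff of every other public signal, whatever its measurable
space of realizations. -/
def IsOptimalSignal {n : ℕ} (β : ℝ) (g gt : Matrix (Fin n) (Fin n) ℝ)
    (P : Measure (StateSpace n)) [IsProbabilityMeasure P]
    {M : Type u} [MeasurableSpace M] (φ : Kernel (StateSpace n) M) [IsMarkovKernel φ] : Prop :=
  ∃ α : M → Fin n → ℝ, IsEquilibrium β g P φ α ∧
    ∀ (M' : Type v) [MeasurableSpace M'] (φ' : Kernel (StateSpace n) M') [IsMarkovKernel φ']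
      (α' : M' → Fin n → ℝ), IsEquilibrium β g P φ' α' →
        principalValue β gt P φ' α' ≤ principalValue β gt P φ α

/-- The list of linear statistics `(wⱼ' x)ⱼ` of the state. -/
def linearStatistics {n : ℕ} {ι : Type} (w : ι → StateSpace n) (x : StateSpace n) : ι → ℝ :=
  fun j => ⟪w j, x⟫

theorem measurable_linearStatistics {n : ℕ} {ι : Type} (w : ι → StateSpace n) :
    Measurable (linearStatistics w) := by
  unfold linearStatistics
  fun_prop

/-- The public signal that discloses the linear statistics `(wⱼ' x)ⱼ`. -/
def linearSignal {n : ℕ} {ι : Type} (w : ι → StateSpace n) : Kernel (StateSpace n) (ι → ℝ) :=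
  Kernel.deterministic (linearStatistics w) (measurable_linearStatistics w)

instance {n : ℕ} {ι : Type} (w : ι → StateSpace n) : IsMarkovKernel (linearSignal w) := by
  unfold linearSignal
  infer_instance

/-- The information that the statistics `(wⱼ' x)ⱼ` convey: the σ-algebra they generate. -/
abbrev information {n : ℕ} {ι : Type} (w : ι → StateSpace n) : MeasurableSpace (StateSpace n) :=
  MeasurableSpace.comap (linearStatistics w) inferInstance

/-- The signal `φ` informs the agents of the variable `y`: `E[y | m] = y` almost surely. -/
def Informs {n : ℕ} (P : Measure (StateSpace n)) [IsProbabilityMeasure P]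
    {M : Type u} [MeasurableSpace M] (φ : Kernel (StateSpace n) M) [IsMarkovKernel φ]
    (y : StateSpace n → ℝ) : Prop :=
  ∀ᵐ p ∂(P ⊗ₘ φ), ∫ x, y x ∂(posterior φ P p.2) = y p.1

/-- Laplacian matrix `D_g - g` of a weighted graph. -/
def laplacian {n : ℕ} (g : Matrix (Fin n) (Fin n) ℝ) : Matrix (Fin n) (Fin n) ℝ :=
  Matrix.diagonal (fun i => ∑ k, g i k) - g

/-- `B = (I + β L)⁻¹`, the map from the public expectation of the state to equilibrium actions. -/
def equilibriumMatrix {n : ℕ} (β : ℝ) (g : Matrix (Fin n) (Fin n) ℝ) : Matrix (Fin n) (Fin n) ℝ :=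
  (1 + β • laplacian g)⁻¹

/-- `V = B' (I - 2 β (L̃ - L)) B`. -/
def payoffMatrix {n : ℕ} (β : ℝ) (g gt : Matrix (Fin n) (Fin n) ℝ) : Matrix (Fin n) (Fin n) ℝ :=
  (equilibriumMatrix β g)ᵀ * (1 - (2 * β) • (laplacian gt - laplacian g)) * equilibriumMatrix β g

/-- `Σ = σ² [(1 - ρ) I + ρ 1 1']`. -/
def equicorrelation (n : ℕ) (σ ρ : ℝ) : Matrix (Fin n) (Fin n) ℝ :=
  σ ^ 2 • ((1 - ρ) • (1 : Matrix (Fin n) (Fin n) ℝ) + ρ • Matrix.of fun _ _ => 1)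

/-- `Σ^{1/2} V Σ^{1/2}`, with the positive semidefinite square root. -/
def transformedMatrix {n : ℕ} (S V : Matrix (Fin n) (Fin n) ℝ) : Matrix (Fin n) (Fin n) ℝ :=
  CFC.sqrt S * V * CFC.sqrt S

/-- The correlations `ρ ∈ (-1, 1)` for which `Σ` is positive definite, that is, for which it is the
covariance matrix of a nondegenerate Gaussian law. -/
def admissibleCorrelations (n : ℕ) (σ : ℝ) : Set ℝ :=
  {ρ | ρ ∈ Set.Ioo (-1 : ℝ) 1 ∧ (equicorrelation n σ ρ).PosDef}

/-- `q` is an orthonormal basis of eigenvectors of `A`, with eigenvalues `ω`. -/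
def IsEigenbasis {n : ℕ} (A : Matrix (Fin n) (Fin n) ℝ)
    (q : OrthonormalBasis (Fin n) ℝ (StateSpace n)) (ω : Fin n → ℝ) : Prop :=
  ∀ j, A *ᵥ (q j).ofLp = ω j • (q j).ofLp

/-- The vectors `Σ^{-1/2} zⱼ`, so that `zⱼ' Σ^{-1/2} x` is the linear statistic of the `j`-th one. -/
def whitened {n : ℕ} (S : Matrix (Fin n) (Fin n) ℝ)
    (z : OrthonormalBasis (Fin n) ℝ (StateSpace n)) (j : Fin n) : StateSpace n :=
  WithLp.toLp 2 ((CFC.sqrt S)⁻¹ *ᵥ (z j).ofLp)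

/-- The law of the state: `N(μ, Σ)` with equicorrelated `Σ`. -/
abbrev stateLaw {n : ℕ} (μ : StateSpace n) (σ ρ : ℝ) : Measure (StateSpace n) :=
  multivariateGaussian μ (equicorrelation n σ ρ)

end

/-! Agents' payoffs are concave quadratics in their own action, so the equilibrium is `B y` with `y`
the posterior mean of the state. Substituting it, the principal's value is `E[y' V y] - E|x|²`. In
an eigenbasis of `V` this is a weighted sum of second moments of the posterior means of the `q_j'
x`. Each term has a sharp bound: full disclosure of `q_j' x` if `ω_j > 0`, none if `ω_j < 0`. Value
is therefore a constant minus a nonnegative loss (`principalValue_eq_sub_disclosureLoss`). If some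
signal has zero loss, the optimal signals are exactly those with zero loss
(`isOptimalSignal_iff_sortsByWeight`).

For a general covariance, disclosing some `q_i' x` leaks information about others, and zero loss may
be impossible. Here Laplacians annihilate constants, so `V 1 = 1`. Eigenvectors with `ω_j < 0` are
then orthogonal to `1`, hence eigenvectors of `Σ` for `σ²(1 - ρ) > 0`. For such `q_j`, being
uncorrelated with `w' x` means being orthogonal to `w`, whatever `ρ` is
(`dotProduct_equicorrelation_eq_zero_iff`). Gaussianity turns this into independence, so disclosing
the `q_j' x` with `ω_j ≥ 0` has zero loss. For linear signals, optimality becomes a condition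
without `ρ` (`isOptimalSignal_linearSignal_iff`). The whitened statistics span the same subspace
(`span_whitened_eq`). -/

/-! ### Laplacians, the matrix `V`, and square roots of covariance matrices. -/

section LinearAlgebra

variable {n : ℕ}

theorem laplacian_mulVec_apply (g : Matrix (Fin n) (Fin n) ℝ) (a : Fin n → ℝ) (i : Fin n) :
    (laplacian g *ᵥ a) i = ∑ j, g i j * (a i - a j) := by
  simp only [laplacian, sub_mulVec, Pi.sub_apply, mulVec_diagonal, mul_sub,
    Finset.sum_sub_distrib, Finset.sum_mul]
  rfl

theorem laplacian_mulVec_const (g : Matrix (Fin n) (Fin n) ℝ) (c : ℝ) :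
    laplacian g *ᵥ (fun _ => c) = 0 := by
  ext i
  simp [laplacian_mulVec_apply]

theorem laplacian_transpose {g : Matrix (Fin n) (Fin n) ℝ} (hg : g.IsSymm) :
    (laplacian g)ᵀ = laplacian g := by
  simp [laplacian, hg.eq]

/-- Average the expansion with its copy under `i ↔ j`. The ordered double sum counts every edge
twice, which is the origin of the `2 β` in `V`. -/
theorem two_mul_dotProduct_laplacian {g : Matrix (Fin n) (Fin n) ℝ} (hg : g.IsSymm)
    (a : Fin n → ℝ) :
    2 * (a ⬝ᵥ laplacian g *ᵥ a) = ∑ i, ∑ j, g i j * (a i - a j) ^ 2 := by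
  have h1 : a ⬝ᵥ laplacian g *ᵥ a = ∑ i, ∑ j, g i j * (a i * (a i - a j)) := by
    simp only [dotProduct, laplacian_mulVec_apply, Finset.mul_sum]
    exact Finset.sum_congr rfl fun i _ => Finset.sum_congr rfl fun j _ => by ring
  have h2 : a ⬝ᵥ laplacian g *ᵥ a = ∑ i, ∑ j, g i j * (a j * (a j - a i)) := by
    rw [h1, Finset.sum_comm]
    exact Finset.sum_congr rfl fun i _ => Finset.sum_congr rfl fun j _ => by rw [hg.apply]
  rw [two_mul]
  nth_rewrite 1 [h1]
  rw [h2, ← Finset.sum_add_distrib]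
  refine Finset.sum_congr rfl fun i _ => ?_
  rw [← Finset.sum_add_distrib]
  exact Finset.sum_congr rfl fun j _ => by ring

/-- A kernel vector `a` satisfies `|a|² + β a' L a = 0`, and both terms are nonnegative. -/
theorem IsWeightedGraph.isUnit_one_add_smul_laplacian {g : Matrix (Fin n) (Fin n) ℝ}
    (hg : IsWeightedGraph g) {β : ℝ} (hβ : 0 ≤ β) : IsUnit (1 + β • laplacian g) := by
  rw [← mulVec_injective_iff_isUnit, ← coe_mulVecLin, injective_iff_map_eq_zero]
  intro a ha
  have h0 : a ⬝ᵥ a + β * (a ⬝ᵥ laplacian g *ᵥ a) = 0 := by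
    have := congrArg (a ⬝ᵥ ·) ha
    simpa [add_mulVec, smul_mulVec, dotProduct_add, dotProduct_smul] using this
  have h1 : 0 ≤ a ⬝ᵥ laplacian g *ᵥ a := by
    have := two_mul_dotProduct_laplacian hg.symm a
    have : 0 ≤ ∑ i, ∑ j, g i j * (a i - a j) ^ 2 :=
      Finset.sum_nonneg fun i _ => Finset.sum_nonneg fun j _ =>
        mul_nonneg (hg.mem_Icc i j).1 (sq_nonneg _)
    linarith
  have h2 : 0 ≤ a ⬝ᵥ a := Finset.sum_nonneg fun i _ => mul_self_nonneg _
  exact dotProduct_self_eq_zero.1 (by nlinarith [mul_nonneg hβ h1])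

theorem IsWeightedGraph.equilibriumMatrix_mulVec_eq_iff {g : Matrix (Fin n) (Fin n) ℝ}
    (hg : IsWeightedGraph g) {β : ℝ} (hβ : 0 ≤ β) (a y : Fin n → ℝ) :
    a = equilibriumMatrix β g *ᵥ y ↔ (1 + β • laplacian g) *ᵥ a = y := by
  have hu := (isUnit_iff_isUnit_det _).1 (hg.isUnit_one_add_smul_laplacian hβ)
  unfold equilibriumMatrix
  constructor
  · rintro rfl
    rw [mulVec_mulVec, mul_nonsing_inv _ hu, one_mulVec]
  · rintro rfl
    rw [mulVec_mulVec, nonsing_inv_mul _ hu, one_mulVec]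

theorem equilibriumMatrix_transpose {g : Matrix (Fin n) (Fin n) ℝ} (hg : g.IsSymm) (β : ℝ) :
    (equilibriumMatrix β g)ᵀ = equilibriumMatrix β g := by
  rw [equilibriumMatrix, transpose_nonsing_inv, transpose_add, transpose_smul, transpose_one,
    laplacian_transpose hg]

theorem payoffMatrix_isSymm {g gt : Matrix (Fin n) (Fin n) ℝ} (hg : g.IsSymm) (hgt : gt.IsSymm)
    (β : ℝ) : (payoffMatrix β g gt).IsSymm := by
  simp [Matrix.IsSymm, payoffMatrix, equilibriumMatrix_transpose hg, laplacian_transpose hg,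
    laplacian_transpose hgt, Matrix.mul_assoc]

/-- Laplacians kill constants, so `B` fixes them and so does `V`. That this eigenvalue is positive
keeps eigenvectors with negative eigenvalue orthogonal to `1`. -/
theorem IsWeightedGraph.payoffMatrix_mulVec_const {g gt : Matrix (Fin n) (Fin n) ℝ}
    (hg : IsWeightedGraph g) {β : ℝ} (hβ : 0 ≤ β) (c : ℝ) :
    payoffMatrix β g gt *ᵥ (fun _ => c) = fun _ => c := by
  have hB : equilibriumMatrix β g *ᵥ (fun _ => c) = fun _ => c :=
    ((hg.equilibriumMatrix_mulVec_eq_iff hβ _ _).2 (by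
      simp [add_mulVec, smul_mulVec, laplacian_mulVec_const])).symm
  rw [payoffMatrix, equilibriumMatrix_transpose hg.symm, ← mulVec_mulVec, hB, ← mulVec_mulVec,
    sub_mulVec, smul_mulVec, sub_mulVec, laplacian_mulVec_const, laplacian_mulVec_const]
  simpa using hB

theorem dotProduct_mulVec_comm {A : Matrix (Fin n) (Fin n) ℝ} (hA : A.IsSymm) (u v : Fin n → ℝ) :
    u ⬝ᵥ A *ᵥ v = A *ᵥ u ⬝ᵥ v := by
  rw [dotProduct_mulVec, ← mulVec_transpose, hA.eq]

theorem dotProduct_eq_zero_of_eigenvalues_ne {A : Matrix (Fin n) (Fin n) ℝ} (hA : A.IsSymm)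
    {u v : Fin n → ℝ} {a b : ℝ} (hu : A *ᵥ u = a • u) (hv : A *ᵥ v = b • v) (hab : a ≠ b) :
    u ⬝ᵥ v = 0 := by
  have := dotProduct_mulVec_comm hA u v
  rw [hu, hv, dotProduct_smul, smul_dotProduct, smul_eq_mul, smul_eq_mul] at this
  have h : (a - b) * (u ⬝ᵥ v) = 0 := by linarith
  exact (mul_eq_zero.1 h).resolve_left (sub_ne_zero.2 hab)

theorem equicorrelation_mulVec (σ ρ : ℝ) (q : Fin n → ℝ) :
    equicorrelation n σ ρ *ᵥ q = fun i => σ ^ 2 * ((1 - ρ) * q i + ρ * ∑ j, q j) := by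
  ext i
  simp only [equicorrelation, smul_mulVec, add_mulVec, one_mulVec, Pi.smul_apply, Pi.add_apply,
    smul_eq_mul]
  simp [mulVec, dotProduct]

theorem equicorrelation_mulVec_of_sum_eq_zero (σ ρ : ℝ) {q : Fin n → ℝ} (hq : ∑ i, q i = 0) :
    equicorrelation n σ ρ *ᵥ q = (σ ^ 2 * (1 - ρ)) • q := by
  rw [equicorrelation_mulVec, hq]
  ext i
  simp [mul_assoc]

theorem equicorrelation_mulVec_const (σ ρ : ℝ) (c : ℝ) :
    equicorrelation n σ ρ *ᵥ (fun _ => c) = (σ ^ 2 * (1 - ρ + ρ * n)) • fun _ => c := by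
  rw [equicorrelation_mulVec]
  ext i
  simp
  ring

theorem eigenvalue_pos_of_posDef {S : Matrix (Fin n) (Fin n) ℝ} (hS : S.PosDef) {q : Fin n → ℝ}
    (hq : q ≠ 0) {s : ℝ} (h : S *ᵥ q = s • q) : 0 < s := by
  have h1 := hS.dotProduct_mulVec_pos hq
  have h2 : 0 < q ⬝ᵥ q := by
    simpa using dotProduct_star_self_pos_iff.2 hq
  rw [h, star_trivial, dotProduct_smul, smul_eq_mul] at h1
  exact pos_of_mul_pos_left h1 h2.le

theorem isSymm_sqrt (S : Matrix (Fin n) (Fin n) ℝ) : (CFC.sqrt S).IsSymm := by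
  have := (Matrix.nonneg_iff_posSemidef.1 (CFC.sqrt_nonneg S)).isHermitian.eq
  rwa [conjTranspose_eq_transpose_of_trivial] at this

/-- With `R = √S` and `d = R q - √s q`, one has `(R + √s) d = S q - s q = 0`; since `R ≥ 0` and `√s
> 0`, this forces `d = 0`. -/
theorem sqrt_mulVec_of_eigenvector {S : Matrix (Fin n) (Fin n) ℝ} (hS : S.PosSemidef)
    {q : Fin n → ℝ} {s : ℝ} (hs : 0 < s) (h : S *ᵥ q = s • q) :
    CFC.sqrt S *ᵥ q = √s • q := by
  have hR := Matrix.nonneg_iff_posSemidef.1 (CFC.sqrt_nonneg S)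
  have hRR : CFC.sqrt S * CFC.sqrt S = S := CFC.sqrt_mul_sqrt_self S hS.nonneg
  set R := CFC.sqrt S
  set d := R *ᵥ q - √s • q with hd
  have h1 : R *ᵥ d + √s • d = 0 := by
    rw [hd, mulVec_sub, mulVec_mulVec, hRR, h, mulVec_smul, smul_sub, smul_smul,
      Real.mul_self_sqrt hs.le]
    abel
  have h2 : d ⬝ᵥ R *ᵥ d + √s * (d ⬝ᵥ d) = 0 := by
    have := congrArg (d ⬝ᵥ ·) h1
    simpa [dotProduct_add, dotProduct_smul] using this
  have h3 : 0 ≤ d ⬝ᵥ R *ᵥ d := by simpa using hR.dotProduct_mulVec_nonneg d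
  have h4 : 0 ≤ d ⬝ᵥ d := Finset.sum_nonneg fun i _ => mul_self_nonneg _
  have h5 : d ⬝ᵥ d = 0 := by
    have := mul_nonneg (Real.sqrt_nonneg s) h4
    have h6 : √s * (d ⬝ᵥ d) = 0 := by linarith
    exact (mul_eq_zero.1 h6).resolve_left (Real.sqrt_pos.2 hs).ne'
  exact sub_eq_zero.1 (dotProduct_self_eq_zero.1 h5)

theorem transformedMatrix_isSymm (S : Matrix (Fin n) (Fin n) ℝ) {V : Matrix (Fin n) (Fin n) ℝ}
    (hV : V.IsSymm) : (transformedMatrix S V).IsSymm := by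
  simp [Matrix.IsSymm, transformedMatrix, (isSymm_sqrt S).eq, hV.eq, Matrix.mul_assoc]

theorem isUnit_det_sqrt {S : Matrix (Fin n) (Fin n) ℝ} (hS : S.PosDef) :
    IsUnit (CFC.sqrt S).det := by
  have h := congrArg det (CFC.sqrt_mul_sqrt_self S hS.posSemidef.nonneg)
  rw [det_mul] at h
  exact isUnit_iff_ne_zero.2 fun h0 => hS.det_pos.ne' (by rw [← h, h0, zero_mul])

theorem transformedMatrix_mulVec_of_eigenvector {S V : Matrix (Fin n) (Fin n) ℝ}
    (hS : S.PosSemidef) {q : Fin n → ℝ} {s ω : ℝ} (hs : 0 < s) (h : S *ᵥ q = s • q)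
    (hV : V *ᵥ q = ω • q) : transformedMatrix S V *ᵥ q = (s * ω) • q := by
  have hR := sqrt_mulVec_of_eigenvector hS hs h
  rw [transformedMatrix, ← mulVec_mulVec, ← mulVec_mulVec, hR, mulVec_smul, hV, mulVec_smul,
    mulVec_smul, hR, smul_smul, smul_smul]
  congr 1
  rw [mul_comm _ ω, mul_assoc, Real.mul_self_sqrt hs.le, mul_comm]

theorem real_inner_eq_dotProduct (x y : StateSpace n) : ⟪x, y⟫ = x.ofLp ⬝ᵥ y.ofLp := by
  rw [EuclideanSpace.inner_eq_star_dotProduct, star_trivial, dotProduct_comm]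

theorem IsEigenbasis.dotProduct_mulVec {A : Matrix (Fin n) (Fin n) ℝ}
    {q : OrthonormalBasis (Fin n) ℝ (StateSpace n)} {ω : Fin n → ℝ} (h : IsEigenbasis A q ω)
    (x : StateSpace n) : x.ofLp ⬝ᵥ A *ᵥ x.ofLp = ∑ j, ω j * ⟪q j, x⟫ ^ 2 := by
  have hx : A *ᵥ x.ofLp = (∑ j, (ω j * ⟪q j, x⟫) • q j).ofLp := by
    conv_lhs => rw [← q.sum_repr' x]
    simp only [WithLp.ofLp_sum, WithLp.ofLp_smul, mulVec_sum, mulVec_smul, h _, smul_smul]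
    exact Finset.sum_congr rfl fun j _ => by rw [mul_comm]
  rw [hx, ← real_inner_eq_dotProduct, inner_sum]
  refine Finset.sum_congr rfl fun j _ => ?_
  rw [real_inner_smul_right, real_inner_comm]
  ring

end LinearAlgebra

/-! ### Posterior means: tower property, Pythagorean identities, independence. -/

noncomputable section PosteriorMean

variable {Ω : Type v} [MeasurableSpace Ω] {M : Type u} [MeasurableSpace M]
  {P : Measure Ω} [IsProbabilityMeasure P] {φ : Kernel Ω M} [IsMarkovKernel φ]

theorem measurePreserving_fst_compProd :
    MeasurePreserving Prod.fst (P ⊗ₘ φ) P :=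
  ⟨measurable_fst, Measure.fst_compProd P φ⟩

theorem measurePreserving_snd_compProd :
    MeasurePreserving Prod.snd (P ⊗ₘ φ) (φ ∘ₘ P) :=
  ⟨measurable_snd, Measure.snd_compProd P φ⟩

theorem integral_compProd_fst (Y : Ω → ℝ) (hY : AEStronglyMeasurable Y P) :
    ∫ z, Y z.1 ∂(P ⊗ₘ φ) = ∫ x, Y x ∂P := by
  conv_rhs => rw [← (measurePreserving_fst_compProd (P := P) (φ := φ)).map_eq]
  rw [integral_map measurable_fst.aemeasurable]
  rwa [measurePreserving_fst_compProd.map_eq]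

theorem integral_compProd_snd (h : M → ℝ) (hh : AEStronglyMeasurable h (φ ∘ₘ P)) :
    ∫ z, h z.2 ∂(P ⊗ₘ φ) = ∫ m, h m ∂(φ ∘ₘ P) := by
  conv_rhs => rw [← (measurePreserving_snd_compProd (P := P) (φ := φ)).map_eq]
  rw [integral_map measurable_snd.aemeasurable]
  rwa [measurePreserving_snd_compProd.map_eq]

theorem indepFun_compProd_deterministic {Y : Ω → ℝ} {f : Ω → M} (hf : Measurable f) (hYm : Measurable Y)
    (hind : IndepFun Y f P) :
    IndepFun (fun z : Ω × M => Y z.1) Prod.snd (P ⊗ₘ Kernel.deterministic f hf) := by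
  rw [Measure.compProd_deterministic]
  rw [indepFun_iff_measure_inter_preimage_eq_mul] at hind ⊢
  intro s t hs ht
  have hm : Measurable fun x => (x, f x) := measurable_id.prodMk hf
  have h1 : MeasurableSet ((fun z : Ω × M => Y z.1) ⁻¹' s) := (hYm.comp measurable_fst) hs
  have h2 : MeasurableSet ((Prod.snd : Ω × M → M) ⁻¹' t) := measurable_snd ht
  rw [Measure.map_apply hm (h1.inter h2), Measure.map_apply hm h1, Measure.map_apply hm h2]
  exact hind s t hs ht

variable [StandardBorelSpace Ω] [Nonempty Ω]

/-- The expectation of `Y` under the posterior given `m`. -/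
def posteriorMean (P : Measure Ω) [IsProbabilityMeasure P] (φ : Kernel Ω M) [IsMarkovKernel φ]
    (Y : Ω → ℝ) (m : M) : ℝ :=
  ∫ x, Y x ∂(posterior φ P m)

variable {Y : Ω → ℝ}

theorem measurePreserving_swap_compProd :
    MeasurePreserving Prod.swap (P ⊗ₘ φ) ((φ ∘ₘ P) ⊗ₘ posterior φ P) :=
  ⟨measurable_swap, (compProd_posterior_eq_map_swap).symm⟩

theorem ae_compProd_iff_posterior {p : Ω × M → Prop} :
    (∀ᵐ z ∂(P ⊗ₘ φ), p z) ↔ ∀ᵐ z ∂((φ ∘ₘ P) ⊗ₘ posterior φ P), p z.swap := by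
  have h := (measurePreserving_swap_compProd (P := P) (φ := φ)).map_eq
  rw [← h]
  have := (MeasurableEquiv.prodComm (α := Ω) (β := M)).measurableEmbedding.ae_map_iff
    (p := fun z => p z.swap) (μ := P ⊗ₘ φ)
  exact this.symm

theorem integrable_compProd_posterior {F : Ω × M → ℝ} (hF : Integrable F (P ⊗ₘ φ)) :
    Integrable (F ∘ Prod.swap) ((φ ∘ₘ P) ⊗ₘ posterior φ P) := by
  have h := (measurePreserving_swap_compProd (P := P) (φ := φ)).map_eq
  rw [← h]
  exact (MeasurableEquiv.prodComm (α := Ω) (β := M)).measurableEmbedding.integrable_map_iff.2 hF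

theorem integral_compProd_eq_integral_posterior {F : Ω × M → ℝ} (hF : Integrable F (P ⊗ₘ φ)) :
    ∫ z, F z ∂(P ⊗ₘ φ) = ∫ m, ∫ x, F (x, m) ∂(posterior φ P m) ∂(φ ∘ₘ P) := by
  have h1 : ∫ z, F z ∂(P ⊗ₘ φ) = ∫ z, (F ∘ Prod.swap) z ∂((φ ∘ₘ P) ⊗ₘ posterior φ P) := by
    have h := (measurePreserving_swap_compProd (P := P) (φ := φ)).map_eq
    rw [← h]
    have := (MeasurableEquiv.prodComm (α := Ω) (β := M)).measurableEmbedding.integral_map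
      (μ := P ⊗ₘ φ) (F ∘ Prod.swap)
    exact this.symm
  rw [h1, Measure.integral_compProd (integrable_compProd_posterior hF)]
  rfl

theorem integrable_integral_posterior {F : Ω × M → ℝ} (hF : Integrable F (P ⊗ₘ φ)) :
    Integrable (fun m => ∫ x, F (x, m) ∂(posterior φ P m)) (φ ∘ₘ P) := by
  have h := integrable_compProd_posterior hF
  rw [Measure.compProd] at h
  simpa using h.integral_compProd

theorem Integrable.ae_posterior (hY : Integrable Y P) :
    ∀ᵐ m ∂(φ ∘ₘ P), Integrable Y (posterior φ P m) := by
  have h1 : Integrable (fun z : Ω × M => Y z.1) (P ⊗ₘ φ) :=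
    measurePreserving_fst_compProd.integrable_comp_of_integrable hY
  exact (integrable_compProd_posterior h1).ae_of_compProd

theorem MemLp.ae_posterior (hYm : Measurable Y) (hY : MemLp Y 2 P) :
    ∀ᵐ m ∂(φ ∘ₘ P), MemLp Y 2 (posterior φ P m) := by
  filter_upwards [Integrable.ae_posterior (φ := φ) hY.integrable_sq] with m hm
  exact (memLp_two_iff_integrable_sq hYm.aestronglyMeasurable).2 hm

theorem measurable_posteriorMean (hYm : Measurable Y) : Measurable (posteriorMean P φ Y) :=
  (hYm.stronglyMeasurable.integral_kernel (κ := posterior φ P)).measurable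

/-- Conditional Jensen: the posterior variance is nonnegative, so the squared mean is dominated by
the posterior second moment. -/
theorem memLp_posteriorMean (hYm : Measurable Y) (hY : MemLp Y 2 P) :
    MemLp (posteriorMean P φ Y) 2 (φ ∘ₘ P) := by
  refine (memLp_two_iff_integrable_sq (measurable_posteriorMean hYm).aestronglyMeasurable).2 ?_
  have h1 : Integrable (fun z : Ω × M => Y z.1 ^ 2) (P ⊗ₘ φ) :=
    measurePreserving_fst_compProd.integrable_comp_of_integrable hY.integrable_sq
  have h2 := integrable_integral_posterior h1
  refine h2.mono' ((measurable_posteriorMean hYm).pow_const 2).aestronglyMeasurable ?_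
  filter_upwards [MemLp.ae_posterior (φ := φ) hYm hY] with m hm
  have hv := variance_eq_sub hm
  have := variance_nonneg Y (posterior φ P m)
  rw [Real.norm_eq_abs, abs_of_nonneg (sq_nonneg _)]
  simp only [posteriorMean]
  rw [hv] at this
  exact sub_nonneg.1 this

theorem integral_mul_eq_integral_mul_posteriorMean {h : M → ℝ} (hh : MemLp h 2 (φ ∘ₘ P))
    (hY : MemLp Y 2 P) :
    ∫ z, h z.2 * Y z.1 ∂(P ⊗ₘ φ) = ∫ m, h m * posteriorMean P φ Y m ∂(φ ∘ₘ P) := by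
  have hi : Integrable (fun z : Ω × M => h z.2 * Y z.1) (P ⊗ₘ φ) :=
    (hh.comp_measurePreserving measurePreserving_snd_compProd).integrable_mul
      (hY.comp_measurePreserving measurePreserving_fst_compProd)
  rw [integral_compProd_eq_integral_posterior hi]
  simp only [integral_const_mul, posteriorMean]

theorem integral_posteriorMean (hY : Integrable Y P) :
    ∫ m, posteriorMean P φ Y m ∂(φ ∘ₘ P) = ∫ x, Y x ∂P := by
  rw [← integral_compProd_fst (φ := φ) Y hY.aestronglyMeasurable,
    integral_compProd_eq_integral_posterior (F := fun z => Y z.1)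
      (measurePreserving_fst_compProd.integrable_comp_of_integrable hY)]
  rfl

/-- Pythagoras: by the tower property the cross term equals the second moment of the posterior mean.
-/
theorem integral_sq_sub_posteriorMean (hYm : Measurable Y) (hY : MemLp Y 2 P) :
    ∫ z, (Y z.1 - posteriorMean P φ Y z.2) ^ 2 ∂(P ⊗ₘ φ) =
      ∫ x, Y x ^ 2 ∂P - ∫ m, posteriorMean P φ Y m ^ 2 ∂(φ ∘ₘ P) := by
  have hM := memLp_posteriorMean (φ := φ) hYm hY
  have hY' := hY.comp_measurePreserving (measurePreserving_fst_compProd (P := P) (φ := φ))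
  have hM' := hM.comp_measurePreserving (measurePreserving_snd_compProd (P := P) (φ := φ))
  have h1 := integral_mul_eq_integral_mul_posteriorMean hM hY
  have h2 := integral_compProd_fst (φ := φ) (fun x => Y x ^ 2) hY.integrable_sq.aestronglyMeasurable
  have h3 := integral_compProd_snd _ hM.integrable_sq.aestronglyMeasurable
  have hi := hM'.integrable_mul hY'
  calc ∫ z, (Y z.1 - posteriorMean P φ Y z.2) ^ 2 ∂(P ⊗ₘ φ)
      = ∫ z, (Y z.1 ^ 2 - 2 * (posteriorMean P φ Y z.2 * Y z.1)
          + posteriorMean P φ Y z.2 ^ 2) ∂(P ⊗ₘ φ) := by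
        congr with z; ring
    _ = _ := by
        rw [integral_add, integral_sub, integral_const_mul, h1, h2, h3]
        · simp only [← pow_two]; ring
        · exact hY'.integrable_sq
        · exact hi.const_mul 2
        · exact hY'.integrable_sq.sub (hi.const_mul 2)
        · exact hM'.integrable_sq

theorem integral_sq_posteriorMean_sub (hYm : Measurable Y) (hY : MemLp Y 2 P) :
    ∫ m, (posteriorMean P φ Y m - ∫ x, Y x ∂P) ^ 2 ∂(φ ∘ₘ P) =
      ∫ m, posteriorMean P φ Y m ^ 2 ∂(φ ∘ₘ P) - (∫ x, Y x ∂P) ^ 2 := by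
  have hM := memLp_posteriorMean (φ := φ) hYm hY
  have hi := hM.integrable one_le_two
  rw [← integral_posteriorMean (φ := φ) (hY.integrable one_le_two)]
  have h1 := variance_eq_sub hM
  rw [variance_eq_integral hi.aemeasurable] at h1
  simpa using h1

theorem posteriorMean_ae_eq_of_ae_eq {h : M → ℝ}
    (hh : ∀ᵐ z ∂(P ⊗ₘ φ), Y z.1 = h z.2) :
    ∀ᵐ m ∂(φ ∘ₘ P), posteriorMean P φ Y m = h m := by
  have h1 := Measure.ae_ae_of_ae_compProd (ae_compProd_iff_posterior.1 hh)
  filter_upwards [h1] with m hm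
  rw [posteriorMean, integral_congr_ae (f := Y) (g := fun _ => h m) hm]
  simp

/-- Both sides have the same integral over every measurable set of realizations: integrate `Y`
against its indicator and factor by independence. -/
theorem posteriorMean_ae_eq_const_of_indepFun (hY : Integrable Y P)
    (hind : IndepFun (fun z : Ω × M => Y z.1) Prod.snd (P ⊗ₘ φ)) :
    ∀ᵐ m ∂(φ ∘ₘ P), posteriorMean P φ Y m = ∫ x, Y x ∂P := by
  have hYp : Integrable (fun z : Ω × M => Y z.1) (P ⊗ₘ φ) :=
    measurePreserving_fst_compProd.integrable_comp_of_integrable hY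
  have hM : Integrable (posteriorMean P φ Y) (φ ∘ₘ P) :=
    integrable_integral_posterior (F := fun z : Ω × M => Y z.1) hYp
  refine hM.ae_eq_of_forall_setIntegral_eq _ _ (integrable_const _) fun s hs _ => ?_
  have hgm : Measurable (s.indicator fun _ => (1 : ℝ)) := measurable_const.indicator hs
  have hi : Integrable (fun z : Ω × M => s.indicator (fun _ => (1 : ℝ)) z.2 * Y z.1) (P ⊗ₘ φ) := by
    refine (hYp.indicator (measurable_snd hs)).congr (.of_forall fun z => ?_)
    by_cases hz : z.2 ∈ s <;> simp [Set.indicator, hz]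
  have h1 := integral_compProd_eq_integral_posterior hi
  simp only [integral_const_mul] at h1
  have h2 : ∫ m in s, posteriorMean P φ Y m ∂(φ ∘ₘ P) =
      ∫ m, s.indicator (fun _ => (1 : ℝ)) m * posteriorMean P φ Y m ∂(φ ∘ₘ P) := by
    rw [← integral_indicator hs]
    congr with m
    by_cases hz : m ∈ s <;> simp [hz]
  have h3 : ∫ z, s.indicator (fun _ => (1 : ℝ)) z.2 * Y z.1 ∂(P ⊗ₘ φ) =
      (∫ z, s.indicator (fun _ => (1 : ℝ)) z.2 ∂(P ⊗ₘ φ)) * ∫ z, Y z.1 ∂(P ⊗ₘ φ) :=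
    (hind.comp measurable_id hgm).symm.integral_fun_mul_eq_mul_integral
      (hgm.comp measurable_snd).aestronglyMeasurable hYp.aestronglyMeasurable
  rw [h2]
  refine h1.symm.trans ?_
  rw [h3, integral_compProd_snd _ hgm.aestronglyMeasurable,
    integral_compProd_fst _ hY.aestronglyMeasurable, integral_indicator hs]
  simp

end PosteriorMean

/-! ### Equilibrium, the principal's value, and optimality as zero loss. -/

noncomputable section Game

variable {n : ℕ}

theorem integral_const_sub_sq {Ω : Type*} [MeasurableSpace Ω] {Q : Measure Ω}
    [IsProbabilityMeasure Q] {Y : Ω → ℝ} (hY : MemLp Y 2 Q) (c : ℝ) :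
    ∫ x, (c - Y x) ^ 2 ∂Q = c ^ 2 - 2 * c * ∫ x, Y x ∂Q + ∫ x, Y x ^ 2 ∂Q := by
  have h1 := hY.integrable one_le_two
  have h2 := hY.integrable_sq
  calc ∫ x, (c - Y x) ^ 2 ∂Q = ∫ x, (c ^ 2 - 2 * c * Y x + Y x ^ 2) ∂Q := by
        congr with x; ring
    _ = _ := by
        rw [integral_add _ h2, integral_sub (integrable_const _) (h1.const_mul _), integral_const_mul]
        · simp
        · exact (integrable_const _).sub (h1.const_mul _)

theorem integral_agentPayoff {Q : Measure (StateSpace n)} [IsProbabilityMeasure Q] {i : Fin n}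
    (hQ : MemLp (fun x : StateSpace n => x i) 2 Q) (β : ℝ) (g : Matrix (Fin n) (Fin n) ℝ)
    (a : Fin n → ℝ) :
    ∫ x, agentPayoff β g i a x ∂Q =
      -(a i ^ 2 - 2 * a i * ∫ x, x i ∂Q + ∫ x, x i ^ 2 ∂Q) -
        β * ∑ j, g i j * (a i - a j) ^ 2 := by
  have h : Integrable (fun x : StateSpace n => (a i - x i) ^ 2) Q :=
    ((memLp_const (a i)).sub hQ).integrable_sq
  simp only [agentPayoff]
  rw [integral_sub, integral_neg, integral_const_sub_sq hQ]
  · simp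
  · exact h.neg
  · exact integrable_const _

theorem integral_principalPayoff {Q : Measure (StateSpace n)} [IsProbabilityMeasure Q]
    (hQ : ∀ i, MemLp (fun x : StateSpace n => x i) 2 Q) (β : ℝ) (gt : Matrix (Fin n) (Fin n) ℝ)
    (a : Fin n → ℝ) :
    ∫ x, principalPayoff β gt a x ∂Q =
      -∑ i, (a i ^ 2 - 2 * a i * ∫ x, x i ∂Q + ∫ x, x i ^ 2 ∂Q) -
        β * ∑ i, ∑ j, gt i j * (a i - a j) ^ 2 := by
  have h : ∀ i, Integrable (fun x : StateSpace n => (a i - x i) ^ 2) Q := fun i =>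
    ((memLp_const (a i)).sub (hQ i)).integrable_sq
  simp only [principalPayoff]
  rw [integral_sub, integral_neg, integral_finsetSum _ fun i _ => h i]
  · simp [integral_const_sub_sq (hQ _)]
  · exact (integrable_finsetSum _ fun i _ => h i).neg
  · exact integrable_const _

/-- The gain of agent `i` from moving to `d` is `-(k (d - aᵢ)² + 2 c (d - aᵢ))` with `k > 0`. No
move is profitable iff `c = 0`, which is row `i` of `(I + β L) a = E[x]`. -/
theorem forall_bestResponse_iff {g : Matrix (Fin n) (Fin n) ℝ} (hg : IsWeightedGraph g)
    {β : ℝ} (hβ : 0 ≤ β) {Q : Measure (StateSpace n)} [IsProbabilityMeasure Q]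
    (hQ : ∀ i, MemLp (fun x : StateSpace n => x i) 2 Q) (a : Fin n → ℝ) :
    (∀ (i : Fin n) (d : ℝ), ∫ x, agentPayoff β g i (Function.update a i d) x ∂Q ≤
        ∫ x, agentPayoff β g i a x ∂Q) ↔
      a = equilibriumMatrix β g *ᵥ fun i => ∫ x, x i ∂Q := by
  rw [hg.equilibriumMatrix_mulVec_eq_iff hβ, funext_iff]
  refine forall_congr' fun i => ?_
  set X := ∫ x, x i ∂Q
  set k := 1 + β * ∑ j, g i j with hk
  have hk1 : 0 < k := by
    have := mul_nonneg hβ (Finset.sum_nonneg fun j (_ : j ∈ Finset.univ) => (hg.mem_Icc i j).1)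
    linarith
  set c := a i + β * ∑ j, g i j * (a i - a j) - X with hc
  have hLHS : ((1 + β • laplacian g) *ᵥ a) i = X ↔ c = 0 := by
    simp only [add_mulVec, one_mulVec, smul_mulVec, Pi.add_apply, Pi.smul_apply, smul_eq_mul,
      laplacian_mulVec_apply]
    rw [hc, sub_eq_zero]
  have hgain : ∀ d, ∫ x, agentPayoff β g i a x ∂Q -
      ∫ x, agentPayoff β g i (Function.update a i d) x ∂Q =
        k * (d - a i) ^ 2 + 2 * c * (d - a i) := by
    intro d
    have hs : ∑ j, g i j * (Function.update a i d i - Function.update a i d j) ^ 2 =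
        (∑ j, g i j) * (d - a i) ^ 2 + 2 * (d - a i) * ∑ j, g i j * (a i - a j) +
          ∑ j, g i j * (a i - a j) ^ 2 := by
      rw [Finset.sum_mul, Finset.mul_sum, ← Finset.sum_add_distrib, ← Finset.sum_add_distrib]
      refine Finset.sum_congr rfl fun j _ => ?_
      -- For `j = i` the left term is zero, while the right one vanishes only because the diagonal
      -- of `g` does.
      rcases eq_or_ne j i with rfl | hj
      · simp [hg.diag]
      · rw [Function.update_self, Function.update_of_ne hj]
        ring
    rw [integral_agentPayoff (hQ i), integral_agentPayoff (hQ i), hs, Function.update_self, hk, hc]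
    ring
  rw [hLHS]
  constructor
  · intro h
    -- The most profitable deviation, with gain `c² / k`.
    have h1 := hgain (a i - c / k)
    have h2 := h (a i - c / k)
    have h3 : k * (a i - c / k - a i) ^ 2 + 2 * c * (a i - c / k - a i) = -(c ^ 2 / k) := by
      field_simp
      ring
    have h4 : 0 ≤ c ^ 2 / k := by positivity
    have h5 : c ^ 2 / k = 0 := by linarith
    have h6 := (div_eq_zero_iff.1 h5).resolve_right hk1.ne'
    exact pow_eq_zero_iff two_ne_zero |>.1 h6
  · intro h d
    have h1 := hgain d
    rw [h] at h1
    nlinarith [mul_nonneg hk1.le (sq_nonneg (d - a i))]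

theorem memLp_coord {P : Measure (StateSpace n)} (hP : MemLp id 2 P) (i : Fin n) : MemLp (fun x : StateSpace n => x i) 2 P :=
  MemLp.eval_piLp (f := id) hP i

theorem memLp_inner {P : Measure (StateSpace n)} (hP : MemLp id 2 P) (q : StateSpace n) :
    MemLp (fun x : StateSpace n => ⟪q, x⟫) 2 P :=
  hP.const_inner q

variable {M : Type u} [MeasurableSpace M]

/-- The vector of posterior means of the state. -/
def posteriorState (P : Measure (StateSpace n)) [IsProbabilityMeasure P]
    (φ : Kernel (StateSpace n) M) [IsMarkovKernel φ] (m : M) : StateSpace n :=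
  WithLp.toLp 2 fun i => posteriorMean P φ (fun x => x i) m

variable {P : Measure (StateSpace n)} [IsProbabilityMeasure P]
  {φ : Kernel (StateSpace n) M} [IsMarkovKernel φ]

theorem ae_memLp_coord_posterior (hP : MemLp id 2 P) :
    ∀ᵐ m ∂(φ ∘ₘ P), ∀ i, MemLp (fun x : StateSpace n => x i) 2 (posterior φ P m) :=
  ae_all_iff.2 fun i => MemLp.ae_posterior (by fun_prop) (memLp_coord hP i)

theorem posteriorMean_inner_ae_eq (hP : MemLp id 2 P) (q : StateSpace n) :
    ∀ᵐ m ∂(φ ∘ₘ P), posteriorMean P φ (fun x => ⟪q, x⟫) m = ⟪q, posteriorState P φ m⟫ := by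
  filter_upwards [ae_memLp_coord_posterior (φ := φ) hP] with m hm
  simp only [posteriorMean, posteriorState, PiLp.inner_apply, RCLike.inner_apply, conj_trivial]
  rw [integral_finsetSum _ fun i _ => ((hm i).integrable one_le_two).mul_const _]
  simp only [integral_mul_const]

theorem measurable_posteriorState : Measurable (posteriorState P φ) := by
  refine (WithLp.measurable_toLp 2 _).comp (measurable_pi_lambda _ fun i => ?_)
  exact measurable_posteriorMean (by fun_prop)

theorem isEquilibrium_iff {g : Matrix (Fin n) (Fin n) ℝ} (hg : IsWeightedGraph g)
    {β : ℝ} (hβ : 0 ≤ β) (hP : MemLp id 2 P) (α : M → Fin n → ℝ) :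
    IsEquilibrium β g P φ α ↔ Measurable α ∧
      ∀ᵐ m ∂(φ ∘ₘ P), α m = equilibriumMatrix β g *ᵥ (posteriorState P φ m).ofLp := by
  refine and_congr_right fun _ => Filter.eventually_congr ?_
  filter_upwards [ae_memLp_coord_posterior (φ := φ) hP] with m hm
  exact forall_bestResponse_iff hg hβ hm (α m)

theorem exists_isEquilibrium {g : Matrix (Fin n) (Fin n) ℝ} (hg : IsWeightedGraph g)
    {β : ℝ} (hβ : 0 ≤ β) (hP : MemLp id 2 P) (φ : Kernel (StateSpace n) M) [IsMarkovKernel φ] :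
    ∃ α : M → Fin n → ℝ, IsEquilibrium β g P φ α := by
  refine ⟨fun m => equilibriumMatrix β g *ᵥ (posteriorState P φ m).ofLp,
    (isEquilibrium_iff hg hβ hP _).2 ⟨?_, .of_forall fun _ => rfl⟩⟩
  have h : Continuous fun y : StateSpace n => equilibriumMatrix β g *ᵥ y.ofLp := by fun_prop
  exact h.measurable.comp measurable_posteriorState

/-- Substituting `y = (I + β L) a` gives `2 a' y - a' a = a' a + 2 β a' L a`, and the principal's
coordination penalty is `2 β a' L̃ a`. The difference is the quadratic form defining `V`. -/
theorem dotProduct_payoffMatrix {g gt : Matrix (Fin n) (Fin n) ℝ} (hg : IsWeightedGraph g)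
    (hgt : IsWeightedGraph gt) {β : ℝ} (hβ : 0 ≤ β) {a y : Fin n → ℝ}
    (ha : a = equilibriumMatrix β g *ᵥ y) :
    y ⬝ᵥ payoffMatrix β g gt *ᵥ y =
      -∑ i, (a i ^ 2 - 2 * a i * y i) - β * ∑ i, ∑ j, gt i j * (a i - a j) ^ 2 := by
  have h1 : y ⬝ᵥ payoffMatrix β g gt *ᵥ y =
      a ⬝ᵥ (1 - (2 * β) • (laplacian gt - laplacian g)) *ᵥ a := by
    rw [payoffMatrix, ← mulVec_mulVec, ← mulVec_mulVec, ← ha, dotProduct_mulVec, vecMul_transpose, ← ha]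
  have h2 := (hg.equilibriumMatrix_mulVec_eq_iff hβ a y).1 ha
  have h3 : ∑ i, (a i ^ 2 - 2 * a i * y i) = a ⬝ᵥ a - 2 * (a ⬝ᵥ y) := by
    simp only [dotProduct, Finset.mul_sum, ← Finset.sum_sub_distrib]
    exact Finset.sum_congr rfl fun i _ => by ring
  rw [h1, h3, ← two_mul_dotProduct_laplacian hgt.symm, ← h2]
  simp only [sub_mulVec, add_mulVec, one_mulVec, smul_mulVec, dotProduct_sub, dotProduct_add,
    dotProduct_smul, smul_eq_mul]
  ring

theorem integrable_principalPayoff (β : ℝ) (gt : Matrix (Fin n) (Fin n) ℝ) (hP : MemLp id 2 P)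
    {α : M → Fin n → ℝ} (hα : ∀ i, MemLp (fun m => α m i) 2 (φ ∘ₘ P)) :
    Integrable (fun z => principalPayoff β gt (α z.2) z.1) (P ⊗ₘ φ) := by
  have hα' := fun i => (hα i).comp_measurePreserving
    (measurePreserving_snd_compProd (P := P) (φ := φ))
  have hx := fun i => (memLp_coord hP i).comp_measurePreserving
    (measurePreserving_fst_compProd (P := P) (φ := φ))
  refine Integrable.sub (Integrable.neg (integrable_finsetSum _ fun i _ => ?_))
    (Integrable.const_mul (integrable_finsetSum _ fun i _ => integrable_finsetSum _ fun j _ =>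
      Integrable.const_mul ?_ _) _)
  · exact ((hα' i).sub (hx i)).integrable_sq
  · exact ((hα' i).sub (hα' j)).integrable_sq

theorem memLp_posteriorState (hP : MemLp id 2 P) (i : Fin n) :
    MemLp (fun m => posteriorState P φ m i) 2 (φ ∘ₘ P) :=
  memLp_posteriorMean (by fun_prop) (memLp_coord hP i)

theorem principalValue_eq {g gt : Matrix (Fin n) (Fin n) ℝ} (hg : IsWeightedGraph g)
    (hgt : IsWeightedGraph gt) {β : ℝ} (hβ : 0 ≤ β) (hP : MemLp id 2 P) {α : M → Fin n → ℝ}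
    (hα : IsEquilibrium β g P φ α) {q : OrthonormalBasis (Fin n) ℝ (StateSpace n)}
    {ω : Fin n → ℝ} (hq : IsEigenbasis (payoffMatrix β g gt) q ω) :
    principalValue β gt P φ α =
      ∑ j, ω j * ∫ m, posteriorMean P φ (fun x => ⟪q j, x⟫) m ^ 2 ∂(φ ∘ₘ P) -
        ∑ i, ∫ x, x i ^ 2 ∂P := by
  have hae := ((isEquilibrium_iff hg hβ hP α).1 hα).2
  have hαLp : ∀ i, MemLp (fun m => α m i) 2 (φ ∘ₘ P) := by
    intro i
    have : MemLp (fun m => ∑ k, equilibriumMatrix β g i k * posteriorState P φ m k) 2 (φ ∘ₘ P) :=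
      memLp_finsetSum _ fun k _ => (memLp_posteriorState hP k).const_mul _
    refine this.ae_eq ?_
    filter_upwards [hae] with m hm
    rw [hm]
    rfl
  have hpm := fun j => memLp_posteriorMean (P := P) (φ := φ)
    (Y := fun x => ⟪q j, x⟫) (by fun_prop) (memLp_inner hP (q j))
  have hsq : ∀ i, Integrable (fun z : StateSpace n × M => z.1 i ^ 2) (P ⊗ₘ φ) := fun i =>
    measurePreserving_fst_compProd.integrable_comp_of_integrable
      (g := fun x : StateSpace n => x i ^ 2) (memLp_coord hP i).integrable_sq
  have hsq' : ∀ i, Integrable (fun m => ∫ x, x i ^ 2 ∂(posterior φ P m)) (φ ∘ₘ P) := fun i =>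
    integrable_integral_posterior (F := fun z : StateSpace n × M => z.1 i ^ 2) (hsq i)
  rw [principalValue, integral_compProd_eq_integral_posterior
    (F := fun z => principalPayoff β gt (α z.2) z.1) (integrable_principalPayoff β gt hP hαLp)]
  have hinner : ∀ᵐ m ∂(φ ∘ₘ P), ∫ x, principalPayoff β gt (α m) x ∂(posterior φ P m) =
      ∑ j, ω j * posteriorMean P φ (fun x => ⟪q j, x⟫) m ^ 2 -
        ∑ i, ∫ x, x i ^ 2 ∂(posterior φ P m) := by
    filter_upwards [hae, ae_memLp_coord_posterior (φ := φ) hP,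
      ae_all_iff.2 fun j => posteriorMean_inner_ae_eq (φ := φ) hP (q j)] with m h1 h2 h3
    have h4 := dotProduct_payoffMatrix hg hgt hβ h1
    rw [hq.dotProduct_mulVec] at h4
    rw [integral_principalPayoff h2]
    simp only [h3]
    rw [h4, Finset.sum_add_distrib]
    simp only [posteriorState, posteriorMean]
    ring
  rw [integral_congr_ae hinner, integral_sub, integral_finsetSum, integral_finsetSum]
  · congr 1
    · exact Finset.sum_congr rfl fun j _ => integral_const_mul _ _
    · refine Finset.sum_congr rfl fun i _ => ?_
      exact integral_posteriorMean (φ := φ) (Y := fun x : StateSpace n => x i ^ 2)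
        (memLp_coord hP i).integrable_sq
  · exact fun i _ => hsq' i
  · exact fun j _ => (hpm j).integrable_sq.const_mul _
  · exact integrable_finsetSum _ fun j _ => (hpm j).integrable_sq.const_mul _
  · exact integrable_finsetSum _ fun i _ => hsq' i

/-- The mean square distance of the posterior mean of `Y` from its value under full disclosure of
`Y` if `w` is nonnegative, and under no disclosure otherwise. -/
def disclosureLoss (P : Measure (StateSpace n)) [IsProbabilityMeasure P]
    (φ : Kernel (StateSpace n) M) [IsMarkovKernel φ] (Y : StateSpace n → ℝ) (w : ℝ) : ℝ :=
  if 0 ≤ w then ∫ z, (Y z.1 - posteriorMean P φ Y z.2) ^ 2 ∂(P ⊗ₘ φ)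
  else ∫ m, (posteriorMean P φ Y m - ∫ x, Y x ∂P) ^ 2 ∂(φ ∘ₘ P)

theorem disclosureLoss_nonneg (Y : StateSpace n → ℝ) (w : ℝ) : 0 ≤ disclosureLoss P φ Y w := by
  unfold disclosureLoss
  split_ifs <;> exact integral_nonneg fun _ => sq_nonneg _

/-- The first term on the right is the upper bound over all signals, and the loss is the shortfall
from it. The two cases are the two Pythagorean identities. -/
theorem mul_integral_sq_posteriorMean {Y : StateSpace n → ℝ} (hYm : Measurable Y)
    (hY : MemLp Y 2 P) (w : ℝ) :
    w * ∫ m, posteriorMean P φ Y m ^ 2 ∂(φ ∘ₘ P) =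
      (if 0 ≤ w then w * ∫ x, Y x ^ 2 ∂P else w * (∫ x, Y x ∂P) ^ 2) -
        |w| * disclosureLoss P φ Y w := by
  unfold disclosureLoss
  split_ifs with h
  · rw [integral_sq_sub_posteriorMean hYm hY, abs_of_nonneg h]
    ring
  · rw [integral_sq_posteriorMean_sub hYm hY, abs_of_neg (not_le.1 h)]
    ring

/-- The signal reveals all statistics with positive weight, and nothing on those with negative
weight. -/
def SortsByWeight (P : Measure (StateSpace n)) [IsProbabilityMeasure P]
    (φ : Kernel (StateSpace n) M) [IsMarkovKernel φ] (q : Fin n → StateSpace n)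
    (ω : Fin n → ℝ) : Prop :=
  ∀ j, (0 < ω j → Informs P φ fun x => ⟪q j, x⟫) ∧
    (ω j < 0 → ∀ᵐ m ∂(φ ∘ₘ P), posteriorMean P φ (fun x => ⟪q j, x⟫) m = ∫ x, ⟪q j, x⟫ ∂P)

/-- A vanishing sum of nonnegative terms vanishes termwise, and a zero mean square is almost sure
equality. Indices with `ω j = 0` impose nothing. -/
theorem sortsByWeight_iff (hP : MemLp id 2 P) (q : Fin n → StateSpace n) (ω : Fin n → ℝ) :
    SortsByWeight P φ q ω ↔
      ∑ j, |ω j| * disclosureLoss P φ (fun x => ⟪q j, x⟫) (ω j) = 0 := by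
  rw [Finset.sum_eq_zero_iff_of_nonneg fun j _ =>
    mul_nonneg (abs_nonneg _) (disclosureLoss_nonneg _ _)]
  simp only [Finset.mem_univ, true_imp_iff]
  refine forall_congr' fun j => ?_
  have hy := memLp_inner hP (q j)
  have hpm := memLp_posteriorMean (φ := φ) (Y := fun x => ⟪q j, x⟫) (by fun_prop) hy
  have hy' := hy.comp_measurePreserving (measurePreserving_fst_compProd (P := P) (φ := φ))
  have hpm' := hpm.comp_measurePreserving (measurePreserving_snd_compProd (P := P) (φ := φ))
  rcases lt_trichotomy (ω j) 0 with h | h | h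
  · have hc := (hpm.sub (memLp_const (μ := φ ∘ₘ P) (p := 2) (∫ x, ⟪q j, x⟫ ∂P))).integrable_sq
    have := integral_eq_zero_iff_of_nonneg (fun _ => sq_nonneg _) hc
    simp only [h, h.not_gt, false_imp_iff, true_and, true_imp_iff, disclosureLoss, h.not_ge,
      if_false, mul_eq_zero, abs_eq_zero, h.ne, false_or]
    refine Iff.trans ?_ this.symm
    refine Filter.eventually_congr (.of_forall fun m => ?_)
    simp [sub_eq_zero]
  · simp [h]
  · have hc := (hy'.sub hpm').integrable_sq
    have := integral_eq_zero_iff_of_nonneg (fun _ => sq_nonneg _) hc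
    simp only [h, h.not_gt, false_imp_iff, and_true, true_imp_iff, disclosureLoss, h.le,
      if_true, mul_eq_zero, abs_eq_zero, h.ne', false_or]
    refine Iff.trans ?_ this.symm
    refine Filter.eventually_congr (.of_forall fun z => ?_)
    rw [eq_comm, ← sub_eq_zero]
    simp [posteriorMean]

theorem principalValue_eq_sub_disclosureLoss {g gt : Matrix (Fin n) (Fin n) ℝ}
    (hg : IsWeightedGraph g) (hgt : IsWeightedGraph gt) {β : ℝ} (hβ : 0 ≤ β) (hP : MemLp id 2 P)
    {α : M → Fin n → ℝ} (hα : IsEquilibrium β g P φ α)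
    {q : OrthonormalBasis (Fin n) ℝ (StateSpace n)} {ω : Fin n → ℝ}
    (hq : IsEigenbasis (payoffMatrix β g gt) q ω) :
    principalValue β gt P φ α =
      ∑ j, (if 0 ≤ ω j then ω j * ∫ x, ⟪q j, x⟫ ^ 2 ∂P else ω j * (∫ x, ⟪q j, x⟫ ∂P) ^ 2) -
        ∑ i, ∫ x, x i ^ 2 ∂P - ∑ j, |ω j| * disclosureLoss P φ (fun x => ⟪q j, x⟫) (ω j) := by
  rw [principalValue_eq hg hgt hβ hP hα hq, sub_right_comm]
  congr 1
  rw [← Finset.sum_sub_distrib]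
  exact Finset.sum_congr rfl fun j _ =>
    mul_integral_sq_posteriorMean (φ := φ) (by fun_prop) (memLp_inner hP (q j)) (ω j)

/-- The signal `φ'` shows that the upper bound is attained, so an optimal signal can have no loss
either. -/
theorem isOptimalSignal_iff_sortsByWeight {g gt : Matrix (Fin n) (Fin n) ℝ}
    (hg : IsWeightedGraph g) (hgt : IsWeightedGraph gt) {β : ℝ} (hβ : 0 ≤ β) (hP : MemLp id 2 P)
    {q : OrthonormalBasis (Fin n) ℝ (StateSpace n)} {ω : Fin n → ℝ}
    (hq : IsEigenbasis (payoffMatrix β g gt) q ω)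
    {M' : Type v} [MeasurableSpace M'] {φ' : Kernel (StateSpace n) M'} [IsMarkovKernel φ']
    (hφ' : SortsByWeight P φ' q ω) :
    IsOptimalSignal.{u, v} β g gt P φ ↔ SortsByWeight P φ q ω := by
  rw [sortsByWeight_iff hP] at hφ' ⊢
  constructor
  · rintro ⟨α, hα, hmax⟩
    obtain ⟨α', hα'⟩ := exists_isEquilibrium hg hβ hP φ'
    have h := hmax M' φ' α' hα'
    rw [principalValue_eq_sub_disclosureLoss hg hgt hβ hP hα hq,
      principalValue_eq_sub_disclosureLoss hg hgt hβ hP hα' hq, hφ'] at h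
    have := Finset.sum_nonneg fun j (_ : j ∈ Finset.univ) => mul_nonneg (abs_nonneg (ω j))
      (disclosureLoss_nonneg (P := P) (φ := φ) (fun x => ⟪q j, x⟫) (ω j))
    linarith
  · intro h
    obtain ⟨α, hα⟩ := exists_isEquilibrium hg hβ hP φ
    refine ⟨α, hα, fun M₁ _ φ₁ _ α₁ hα₁ => ?_⟩
    rw [principalValue_eq_sub_disclosureLoss hg hgt hβ hP hα hq,
      principalValue_eq_sub_disclosureLoss hg hgt hβ hP hα₁ hq, h]
    have := Finset.sum_nonneg fun j (_ : j ∈ Finset.univ) => mul_nonneg (abs_nonneg (ω j))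
      (disclosureLoss_nonneg (P := P) (φ := φ₁) (fun x => ⟪q j, x⟫) (ω j))
    linarith

end Game

/-! ### Spans of linear statistics and the information they carry. -/

section Span

variable {n : ℕ} {ι κ : Type}

theorem OrthonormalBasis.mem_span_subtype_of_inner_eq_zero
    (q : OrthonormalBasis (Fin n) ℝ (StateSpace n)) {p : Fin n → Prop} {x : StateSpace n}
    (h : ∀ i, ¬ p i → ⟪q i, x⟫ = 0) :
    x ∈ Submodule.span ℝ (Set.range fun j : {j // p j} => q j) := by
  rw [← q.sum_repr' x]
  refine Submodule.sum_mem _ fun i _ => ?_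
  by_cases hi : p i
  · exact Submodule.smul_mem _ _ (Submodule.subset_span ⟨⟨i, hi⟩, rfl⟩)
  · simp [h i hi]

theorem exists_measurable_inner_eq_of_mem_span [Finite ι] {w : ι → StateSpace n}
    {q : StateSpace n} (hq : q ∈ Submodule.span ℝ (Set.range w)) :
    ∃ h : (ι → ℝ) → ℝ, Measurable h ∧ ∀ x, ⟪q, x⟫ = h (linearStatistics w x) := by
  have := Fintype.ofFinite ι
  obtain ⟨c, rfl⟩ := (Submodule.mem_span_range_iff_exists_fun ℝ).1 hq
  refine ⟨fun t => ∑ i, c i * t i, by fun_prop, fun x => ?_⟩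
  simp [sum_inner, real_inner_smul_left, linearStatistics]

theorem information_le_of_mem_span [Finite κ] {w : ι → StateSpace n} {w' : κ → StateSpace n}
    (h : ∀ i, w i ∈ Submodule.span ℝ (Set.range w')) : information w ≤ information w' := by
  rw [information, ← measurable_iff_comap_le]
  refine @measurable_pi_lambda _ _ _ (information w') _ _ fun i => ?_
  obtain ⟨g, hg, hgw⟩ := exists_measurable_inner_eq_of_mem_span (h i)
  have : (fun x => linearStatistics w x i) = g ∘ linearStatistics w' := funext hgw
  rw [this]
  exact hg.comp (comap_measurable _)

end Span

/-! ### Eigenvectors under equicorrelation. -/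

section Equicorrelation

variable {n : ℕ}

theorem sum_eq_zero_of_eigenvalue_ne {V : Matrix (Fin n) (Fin n) ℝ} (hV : V.IsSymm) {t : ℝ}
    (h1 : V *ᵥ (fun _ => (1 : ℝ)) = t • fun _ => (1 : ℝ)) {q : Fin n → ℝ} {ω : ℝ}
    (hq : V *ᵥ q = ω • q) (hω : ω ≠ t) : ∑ i, q i = 0 := by
  simpa [dotProduct] using dotProduct_eq_zero_of_eigenvalues_ne hV hq h1 hω

/-- In each case `q` is constant or orthogonal to `1`, hence an eigenvector of `Σ` with some `s >
0`, and `τ = s ω`. An eigenvector for `ω = 1` could mix the two kinds. -/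
theorem transformedMatrix_mulVec_sign {V : Matrix (Fin n) (Fin n) ℝ} (hV : V.IsSymm)
    (hV1 : V *ᵥ (fun _ => (1 : ℝ)) = fun _ => (1 : ℝ)) {σ ρ : ℝ}
    (hρ : ρ ∈ admissibleCorrelations n σ) {q : Fin n → ℝ} {ω : ℝ} (hq0 : q ≠ 0)
    (hq : V *ᵥ q = ω • q) (h : ω ≠ 1 ∨ (∃ c : ℝ, q = fun _ => c) ∨ ∑ i, q i = 0) :
    ∃ τ : ℝ, transformedMatrix (equicorrelation n σ ρ) V *ᵥ q = τ • q ∧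
      SignType.sign τ = SignType.sign ω := by
  obtain ⟨s, hs⟩ : ∃ s : ℝ, equicorrelation n σ ρ *ᵥ q = s • q := by
    have hsum : ∑ i, q i = 0 → ∃ s : ℝ, equicorrelation n σ ρ *ᵥ q = s • q := fun h =>
      ⟨_, equicorrelation_mulVec_of_sum_eq_zero σ ρ h⟩
    rcases h with h | ⟨c, rfl⟩ | h
    · exact hsum (sum_eq_zero_of_eigenvalue_ne hV (t := 1) (by rw [hV1, one_smul]) hq h)
    · exact ⟨_, equicorrelation_mulVec_const σ ρ c⟩
    · exact hsum h
  have hs0 := eigenvalue_pos_of_posDef hρ.2 hq0 hs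
  refine ⟨s * ω, transformedMatrix_mulVec_of_eigenvector hρ.2.posSemidef hs0 hs hq, ?_⟩
  rw [sign_mul, sign_pos hs0, one_mul]

/-- Both spans are the orthogonal complement of the negative eigenspace of `V`. Negative
eigenvectors of `V` and of `Σ^{1/2} V Σ^{1/2}` are orthogonal to `1`, where `Σ^{1/2}` is a positive
scalar, so the two negative eigenspaces coincide. -/
theorem span_whitened_eq [NeZero n] {V : Matrix (Fin n) (Fin n) ℝ} (hV : V.IsSymm)
    (hV1 : V *ᵥ (fun _ => (1 : ℝ)) = fun _ => (1 : ℝ)) {σ ρ : ℝ}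
    (hσ : 0 < σ) (hρ : ρ ∈ admissibleCorrelations n σ)
    {q : OrthonormalBasis (Fin n) ℝ (StateSpace n)} {ω : Fin n → ℝ} (hq : IsEigenbasis V q ω)
    {z : OrthonormalBasis (Fin n) ℝ (StateSpace n)} {τ : Fin n → ℝ}
    (hz : IsEigenbasis (transformedMatrix (equicorrelation n σ ρ) V) z τ) :
    Submodule.span ℝ (Set.range fun j : {j : Fin n // 0 ≤ τ j} =>
        whitened (equicorrelation n σ ρ) z j) =
      Submodule.span ℝ (Set.range fun j : {j : Fin n // 0 ≤ ω j} => q j) := by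
  set S := equicorrelation n σ ρ with hS
  have hu := isUnit_det_sqrt hρ.2
  have hRsymm := isSymm_sqrt S
  have hs : 0 < σ ^ 2 * (1 - ρ) := mul_pos (pow_pos hσ 2) (sub_pos.2 hρ.1.2)
  have hsqrt : ∀ {x : Fin n → ℝ}, ∑ i, x i = 0 →
      CFC.sqrt S *ᵥ x = √(σ ^ 2 * (1 - ρ)) • x := fun hx =>
    sqrt_mulVec_of_eigenvector hρ.2.posSemidef hs (equicorrelation_mulVec_of_sum_eq_zero σ ρ hx)
  have hs' : √(σ ^ 2 * (1 - ρ)) ≠ 0 := (Real.sqrt_pos.2 hs).ne'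
  have hVone : V *ᵥ (fun _ => (1 : ℝ)) = (1 : ℝ) • fun _ => (1 : ℝ) := by rw [hV1, one_smul]
  apply le_antisymm
  · rw [Submodule.span_le]
    rintro _ ⟨j, rfl⟩
    refine q.mem_span_subtype_of_inner_eq_zero fun i hi => ?_
    have hi' := not_le.1 hi
    have hsum : ∑ k, q i k = 0 :=
      sum_eq_zero_of_eigenvalue_ne hV hVone (hq i) (by linarith)
    have hT := transformedMatrix_mulVec_of_eigenvector hρ.2.posSemidef hs
      (equicorrelation_mulVec_of_sum_eq_zero σ ρ hsum) (hq i)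
    have h0 := dotProduct_eq_zero_of_eigenvalues_ne (transformedMatrix_isSymm S hV) hT (hz j)
      ((mul_neg_of_pos_of_neg hs hi').trans_le j.2).ne
    have h1 : (z j).ofLp = CFC.sqrt S *ᵥ (whitened S z j).ofLp := by
      rw [whitened, mulVec_mulVec, mul_nonsing_inv _ hu, one_mulVec]
    rw [h1, dotProduct_mulVec_comm hRsymm, hsqrt hsum, smul_dotProduct, smul_eq_mul] at h0
    rw [real_inner_eq_dotProduct]
    exact (mul_eq_zero.1 h0).resolve_left hs'
  · rw [Submodule.span_le]
    rintro _ ⟨i, rfl⟩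
    have hmem : WithLp.toLp 2 (CFC.sqrt S *ᵥ (q i).ofLp) ∈
        Submodule.span ℝ (Set.range fun j : {j // 0 ≤ τ j} => z j) := by
      refine z.mem_span_subtype_of_inner_eq_zero fun j hj => ?_
      have hj' := not_le.1 hj
      have hone : (fun _ : Fin n => (1 : ℝ)) ≠ 0 := fun h => one_ne_zero (congrFun h 0)
      have hS1 := equicorrelation_mulVec_const (n := n) σ ρ 1
      have ht := eigenvalue_pos_of_posDef hρ.2 hone hS1
      have hT1 := transformedMatrix_mulVec_of_eigenvector hρ.2.posSemidef ht hS1 hVone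
      have hsum : ∑ k, z j k = 0 :=
        sum_eq_zero_of_eigenvalue_ne (transformedMatrix_isSymm S hV) hT1 (hz j) (by linarith)
      -- On `z j` the inner root acts as a scalar; cancelling the outer one by injectivity makes `z
      -- j` a negative eigenvector of `V`.
      have hVz : V *ᵥ (z j).ofLp = (τ j / (σ ^ 2 * (1 - ρ))) • (z j).ofLp := by
        have h2 := hz j
        rw [transformedMatrix, ← mulVec_mulVec, ← mulVec_mulVec, hsqrt hsum, mulVec_smul,
          mulVec_smul] at h2
        apply (mulVec_injective_iff_isUnit.2 ((isUnit_iff_isUnit_det _).2 hu))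
        apply smul_right_injective _ hs'
        simp only
        rw [h2, mulVec_smul, hsqrt hsum, smul_smul, smul_smul]
        congr 1
        rw [mul_right_comm, Real.mul_self_sqrt hs.le, mul_div_cancel₀ _ hs.ne']
      have h0 := dotProduct_eq_zero_of_eigenvalues_ne hV hVz (hq i)
        ((div_neg_of_neg_of_pos hj' hs).trans_le i.2).ne
      rw [real_inner_eq_dotProduct, dotProduct_mulVec_comm hRsymm, hsqrt hsum, smul_dotProduct, h0,
        smul_zero]
    -- Applying `Σ^{-1/2}` to this combination of the `z j` expresses `q i` by the whitened vectors.
    obtain ⟨c, hc⟩ := (Submodule.mem_span_range_iff_exists_fun ℝ).1 hmem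
    refine (Submodule.mem_span_range_iff_exists_fun ℝ).2 ⟨c, ?_⟩
    have h1 := congrArg (fun y : StateSpace n => (CFC.sqrt S)⁻¹ *ᵥ y.ofLp) hc
    simp only [WithLp.ofLp_sum, WithLp.ofLp_smul, mulVec_sum, mulVec_smul, mulVec_mulVec,
      hS, nonsing_inv_mul _ hu, one_mulVec] at h1
    refine WithLp.ofLp_injective 2 ?_
    simpa [whitened] using h1

end Equicorrelation

/-! ### An eigenbasis through the vector of ones. -/

section Eigenbasis

/-- A symmetric map fixing `1` preserves its orthogonal complement. Diagonalize there and prepend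
the normalized `1`. -/
theorem exists_eigenbasis_const {n : ℕ} [NeZero n] {V : Matrix (Fin n) (Fin n) ℝ} (hV : V.IsSymm)
    (hV1 : V *ᵥ (fun _ => (1 : ℝ)) = fun _ => (1 : ℝ)) :
    ∃ (q : OrthonormalBasis (Fin n) ℝ (StateSpace n)) (ω : Fin n → ℝ),
      IsEigenbasis V q ω ∧ ∃ c : ℝ, (q 0).ofLp = fun _ => c := by
  obtain ⟨m, rfl⟩ : ∃ m, n = m + 1 := ⟨n - 1, (Nat.sub_add_cancel (NeZero.one_le)).symm⟩
  let e : StateSpace (m + 1) := WithLp.toLp 2 fun _ => 1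
  have he : e ≠ 0 := fun h => one_ne_zero (congrFun (congrArg WithLp.ofLp h) 0)
  let T : StateSpace (m + 1) →ₗ[ℝ] StateSpace (m + 1) := V.toEuclideanLin
  have hTe : T e = e := WithLp.ofLp_injective 2 hV1
  have hT : T.IsSymmetric := by
    refine isSymmetric_toEuclideanLin_iff.2 ?_
    rw [IsHermitian, conjTranspose_eq_transpose_of_trivial, hV.eq]
  have hK : ∀ x ∈ (ℝ ∙ e)ᗮ, T x ∈ (ℝ ∙ e)ᗮ := by
    intro x hx
    rw [Submodule.mem_orthogonal_singleton_iff_inner_right] at hx ⊢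
    rw [← hT, hTe, hx]
  have : Fact (Module.finrank ℝ (StateSpace (m + 1)) = m + 1) := ⟨by simp⟩
  have hdim : Module.finrank ℝ (ℝ ∙ e)ᗮ = m := Submodule.finrank_orthogonal_span_singleton he
  let b := (hT.restrict_invariant hK).eigenvectorBasis hdim
  let w := (hT.restrict_invariant hK).eigenvalues hdim
  have hb : ∀ i, T (b i) = w i • (b i : StateSpace (m + 1)) := fun i =>
    congrArg Subtype.val ((hT.restrict_invariant hK).apply_eigenvectorBasis hdim i)
  let v : Fin (m + 1) → StateSpace (m + 1) := Fin.cons (‖e‖⁻¹ • e) fun i => b i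
  have hv : Orthonormal ℝ v := by
    have hbo : ∀ i, ⟪‖e‖⁻¹ • e, (b i : StateSpace (m + 1))⟫ = 0 := fun i => by
      rw [real_inner_smul_left, Submodule.mem_orthogonal_singleton_iff_inner_right.1 (b i).2,
        mul_zero]
    have hnorm : ‖‖e‖⁻¹ • e‖ = 1 := norm_smul_inv_norm (𝕜 := ℝ) he
    have hbb : ∀ i j, ⟪(b i : StateSpace (m + 1)), (b j : StateSpace (m + 1))⟫ =
        if i = j then 1 else 0 := fun i j => orthonormal_iff_ite.1 b.orthonormal i j
    rw [orthonormal_iff_ite]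
    intro i j
    refine Fin.cases ?_ (fun i => ?_) i <;> refine Fin.cases ?_ (fun j => ?_) j
    · simp [v, hnorm]
    · simp [v, hbo, (Fin.succ_ne_zero j).symm]
    · rw [real_inner_comm]
      simp [v, hbo, Fin.succ_ne_zero i]
    · simp [v, hbb]
  have hcard : Fintype.card (Fin (m + 1)) = Module.finrank ℝ (StateSpace (m + 1)) := by simp
  let B := basisOfOrthonormalOfCardEqFinrank hv hcard
  have hBv : ⇑B = v := coe_basisOfOrthonormalOfCardEqFinrank hv hcard
  let q := B.toOrthonormalBasis (by rw [hBv]; exact hv)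
  have hq : ⇑q = v := by rw [Module.Basis.coe_toOrthonormalBasis, hBv]
  refine ⟨q, Fin.cons 1 w, fun j => ?_, ‖e‖⁻¹, ?_⟩
  · rw [hq]
    refine Fin.cases ?_ (fun j => ?_) j
    · simp only [v, Fin.cons_zero, one_smul]
      exact congrArg WithLp.ofLp (show T (‖e‖⁻¹ • e) = ‖e‖⁻¹ • e by rw [map_smul, hTe])
    · exact congrArg WithLp.ofLp (hb j)
  · rw [hq]
    ext i
    simp [v, e]

end Eigenbasis

/-! ### Linear signals of a Gaussian state. -/

noncomputable section LinearSignals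

variable {n : ℕ} {M : Type u} [MeasurableSpace M]

theorem informs_of_ae_eq {P : Measure (StateSpace n)} [IsProbabilityMeasure P]
    {φ : Kernel (StateSpace n) M} [IsMarkovKernel φ] {Y : StateSpace n → ℝ} {h : M → ℝ}
    (hh : ∀ᵐ z ∂(P ⊗ₘ φ), Y z.1 = h z.2) : Informs P φ Y := by
  have h1 := measurePreserving_snd_compProd.quasiMeasurePreserving.ae
    (posteriorMean_ae_eq_of_ae_eq hh)
  filter_upwards [hh, h1] with z hz hz1
  exact hz1.trans hz.symm

theorem informs_deterministic (P : Measure (StateSpace n)) [IsProbabilityMeasure P]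
    {f : StateSpace n → M} (hf : Measurable f) {Y : StateSpace n → ℝ} (hY : Measurable Y)
    {h : M → ℝ} (hh : Measurable h) (hYf : ∀ x, Y x = h (f x)) :
    Informs P (Kernel.deterministic f hf) Y := by
  refine informs_of_ae_eq (h := h) ?_
  rw [Measure.compProd_deterministic]
  have hs : MeasurableSet {z : StateSpace n × M | Y z.1 = h z.2} :=
    measurableSet_eq_fun (hY.comp measurable_fst) (hh.comp measurable_snd)
  exact (ae_map_iff (measurable_id.prodMk hf).aemeasurable hs).2 (.of_forall hYf)

/-- `E[Z Y] = E[E[Z|m] E[Y|m]] = E[Z] E[Y]`. A signal revealing `Z` leaves the mean of `Y` unmoved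
only if they are uncorrelated; with `Z = Y`, only if the variance is zero. -/
theorem covariance_eq_zero_of_informs {P : Measure (StateSpace n)} [IsProbabilityMeasure P]
    {φ : Kernel (StateSpace n) M} [IsMarkovKernel φ] {Y Z : StateSpace n → ℝ}
    (hY : MemLp Y 2 P) (hZm : Measurable Z) (hZ : MemLp Z 2 P) (hinf : Informs P φ Z)
    (hconst : ∀ᵐ m ∂(φ ∘ₘ P), posteriorMean P φ Y m = ∫ x, Y x ∂P) : cov[Z, Y; P] = 0 := by
  have hpm := memLp_posteriorMean (φ := φ) hZm hZ
  have h1 : ∫ x, Z x * Y x ∂P = (∫ x, Z x ∂P) * ∫ x, Y x ∂P := calc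
    ∫ x, Z x * Y x ∂P = ∫ z, Z z.1 * Y z.1 ∂(P ⊗ₘ φ) :=
        (integral_compProd_fst (fun x => Z x * Y x) (hZ.1.mul hY.1)).symm
    _ = ∫ z, posteriorMean P φ Z z.2 * Y z.1 ∂(P ⊗ₘ φ) := by
        refine integral_congr_ae ?_
        filter_upwards [hinf] with z hz
        rw [posteriorMean, hz]
    _ = ∫ m, posteriorMean P φ Z m * posteriorMean P φ Y m ∂(φ ∘ₘ P) :=
        integral_mul_eq_integral_mul_posteriorMean hpm hY
    _ = ∫ m, posteriorMean P φ Z m * ∫ x, Y x ∂P ∂(φ ∘ₘ P) := by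
        refine integral_congr_ae ?_
        filter_upwards [hconst] with m hm
        rw [hm]
    _ = _ := by rw [integral_mul_const, integral_posteriorMean (hZ.integrable one_le_two)]
  rw [covariance_eq_sub hZ hY, sub_eq_zero]
  exact h1

variable {μ : StateSpace n} {S : Matrix (Fin n) (Fin n) ℝ}

theorem covariance_inner_multivariateGaussian (hS : S.PosSemidef) (x y : StateSpace n) :
    cov[fun u => ⟪x, u⟫, fun u => ⟪y, u⟫; multivariateGaussian μ S] = x.ofLp ⬝ᵥ S *ᵥ y.ofLp := by
  rw [← covarianceBilin_apply_eq_cov IsGaussian.memLp_two_id,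
    covarianceBilin_multivariateGaussian hS]

theorem indepFun_linearStatistics {ι : Type} [Finite ι] (hS : S.PosSemidef) {q : StateSpace n}
    {w : ι → StateSpace n} (h : ∀ i, q.ofLp ⬝ᵥ S *ᵥ (w i).ofLp = 0) :
    IndepFun (fun x => ⟪q, x⟫) (linearStatistics w) (multivariateGaussian μ S) := by
  have := Fintype.ofFinite ι
  let L : StateSpace n →L[ℝ] (Unit → ℝ) × (ι → ℝ) :=
    (ContinuousLinearMap.pi fun _ => innerSL ℝ q).prod
      (ContinuousLinearMap.pi fun i => innerSL ℝ (w i))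
  have hL : HasGaussianLaw (fun x => (fun _ : Unit => ⟪q, x⟫, fun i => ⟪w i, x⟫))
      (multivariateGaussian μ S) :=
    (IsGaussian.hasGaussianLaw_id (μ := multivariateGaussian μ S)).map L
  have hind := hL.indepFun_of_covariance_eval (X := fun _ x => ⟪q, x⟫) (Y := fun i x => ⟪w i, x⟫)
    fun _ i => by rw [covariance_inner_multivariateGaussian hS, h i]
  exact hind.comp (φ := fun t : Unit → ℝ => t ()) (ψ := id) (measurable_pi_apply _) measurable_id

/-- The relabelling `e` of realizations lets the signal live in any universe. -/
theorem sortsByWeight_deterministic {ι : Type} [Finite ι] (hS : S.PosSemidef)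
    {w : ι → StateSpace n} (e : (ι → ℝ) ≃ᵐ M) {q : Fin n → StateSpace n} {ω : Fin n → ℝ}
    (hpos : ∀ j, 0 < ω j → q j ∈ Submodule.span ℝ (Set.range w))
    (hneg : ∀ j, ω j < 0 → ∀ i, (q j).ofLp ⬝ᵥ S *ᵥ (w i).ofLp = 0) :
    SortsByWeight (multivariateGaussian μ S)
      (Kernel.deterministic (e ∘ linearStatistics w)
        (e.measurable.comp (measurable_linearStatistics w))) q ω := by
  intro j
  constructor
  · intro hj
    obtain ⟨h, hm, hh⟩ := exists_measurable_inner_eq_of_mem_span (hpos j hj)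
    exact informs_deterministic _ _ (by fun_prop) (hm.comp e.symm.measurable) fun x => by
      simp [hh x]
  · intro hj
    refine posteriorMean_ae_eq_const_of_indepFun
      ((memLp_inner IsGaussian.memLp_two_id (q j)).integrable one_le_two)
      (indepFun_compProd_deterministic _ (by fun_prop) ?_)
    exact (indepFun_linearStatistics hS (hneg j hj)).comp measurable_id e.measurable

theorem linearSignal_informs {ι : Type} [Finite ι] (P : Measure (StateSpace n))
    [IsProbabilityMeasure P] {w : ι → StateSpace n} {q : StateSpace n}
    (hq : q ∈ Submodule.span ℝ (Set.range w)) : Informs P (linearSignal w) fun x => ⟪q, x⟫ := by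
  obtain ⟨h, hm, hh⟩ := exists_measurable_inner_eq_of_mem_span hq
  exact informs_deterministic _ _ (by fun_prop) hm hh

/-- If `y` is orthogonal to all `w i`, then `(S⁻¹ y)' x` is independent of the signal, so its
covariance with the revealed `q' x`, which is `y' q`, vanishes. Hence `q` lies in the double
orthogonal complement. -/
theorem mem_span_of_linearSignal_informs {ι : Type} [Finite ι] (hS : S.PosDef)
    {w : ι → StateSpace n} {q : StateSpace n}
    (hq : Informs (multivariateGaussian μ S) (linearSignal w) fun x => ⟪q, x⟫) :
    q ∈ Submodule.span ℝ (Set.range w) := by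
  rw [← Submodule.orthogonal_orthogonal (Submodule.span ℝ (Set.range w))]
  intro y hy
  have hyw : ∀ i, ⟪w i, y⟫ = 0 := fun i => hy _ (Submodule.subset_span ⟨i, rfl⟩)
  have hsymm : S.IsSymm := by
    have := hS.isHermitian.eq
    rwa [conjTranspose_eq_transpose_of_trivial] at this
  let v : StateSpace n := WithLp.toLp 2 (S⁻¹ *ᵥ y.ofLp)
  have hv : ∀ x : StateSpace n, v.ofLp ⬝ᵥ S *ᵥ x.ofLp = ⟪y, x⟫ := fun x => by
    rw [dotProduct_mulVec_comm hsymm, mulVec_mulVec,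
      mul_nonsing_inv _ ((isUnit_iff_isUnit_det _).1 hS.isUnit), one_mulVec,
      real_inner_eq_dotProduct]
  have hind : IndepFun (fun x => ⟪v, x⟫) (linearStatistics w) (multivariateGaussian μ S) :=
    indepFun_linearStatistics hS.posSemidef fun i => by rw [hv, real_inner_comm, hyw]
  have hconst := posteriorMean_ae_eq_const_of_indepFun
    ((memLp_inner (P := multivariateGaussian μ S) IsGaussian.memLp_two_id v).integrable one_le_two)
    (indepFun_compProd_deterministic (measurable_linearStatistics w) (by fun_prop) hind)
  have hcov := covariance_eq_zero_of_informs (memLp_inner IsGaussian.memLp_two_id v)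
    (by fun_prop) (memLp_inner IsGaussian.memLp_two_id q) hq hconst
  rw [covariance_comm, covariance_inner_multivariateGaussian hS.posSemidef, hv] at hcov
  exact hcov

theorem sortsByWeight_linearSignal_iff {ι : Type} [Finite ι] (hS : S.PosDef)
    {w : ι → StateSpace n} {q : Fin n → StateSpace n} {ω : Fin n → ℝ} :
    SortsByWeight (multivariateGaussian μ S) (linearSignal w) q ω ↔
      ∀ j, (0 < ω j → q j ∈ Submodule.span ℝ (Set.range w)) ∧
        (ω j < 0 → ∀ i, (q j).ofLp ⬝ᵥ S *ᵥ (w i).ofLp = 0) := by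
  constructor
  · refine fun h j => ⟨fun hj => mem_span_of_linearSignal_informs hS ((h j).1 hj), fun hj i => ?_⟩
    have hcov := covariance_eq_zero_of_informs (memLp_inner IsGaussian.memLp_two_id (q j))
      (by fun_prop) (memLp_inner IsGaussian.memLp_two_id (w i))
      (linearSignal_informs _ (Submodule.subset_span ⟨i, rfl⟩)) ((h j).2 hj)
    rwa [covariance_comm, covariance_inner_multivariateGaussian hS.posSemidef] at hcov
  · intro h
    exact sortsByWeight_deterministic hS.posSemidef (MeasurableEquiv.refl _)
      (fun j => (h j).1) fun j => (h j).2

end LinearSignals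

/-! ### Optimality for equicorrelated states. -/

section Optimality

variable {n : ℕ} {g gt : Matrix (Fin n) (Fin n) ℝ} {β σ ρ : ℝ}

theorem IsWeightedGraph.sum_eq_zero_of_eigenvalue_neg (hg : IsWeightedGraph g)
    (hgt : IsWeightedGraph gt) (hβ : 0 ≤ β) {q : Fin n → ℝ} {ω : ℝ}
    (hq : payoffMatrix β g gt *ᵥ q = ω • q) (hω : ω < 0) : ∑ i, q i = 0 :=
  sum_eq_zero_of_eigenvalue_ne (payoffMatrix_isSymm hg.symm hgt.symm β) (t := 1)
    (by rw [hg.payoffMatrix_mulVec_const hβ, one_smul]) hq (by linarith)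

/-- Here `ρ` drops out: `Σ q = σ²(1 - ρ) q` with a positive factor. -/
theorem dotProduct_equicorrelation_eq_zero_iff (hσ : 0 < σ)
    (hρ : ρ ∈ admissibleCorrelations n σ) {q : StateSpace n} (hq : ∑ i, q i = 0)
    (x : StateSpace n) : q.ofLp ⬝ᵥ equicorrelation n σ ρ *ᵥ x.ofLp = 0 ↔ ⟪q, x⟫ = 0 := by
  have hs : 0 < σ ^ 2 * (1 - ρ) := mul_pos (pow_pos hσ 2) (sub_pos.2 hρ.1.2)
  have hsymm : (equicorrelation n σ ρ).IsSymm := by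
    have := hρ.2.isHermitian.eq
    rwa [conjTranspose_eq_transpose_of_trivial] at this
  rw [dotProduct_mulVec_comm hsymm, equicorrelation_mulVec_of_sum_eq_zero σ ρ hq, smul_dotProduct,
    smul_eq_mul, real_inner_eq_dotProduct, mul_eq_zero, or_iff_right hs.ne']

theorem isOptimalSignal_stateLaw_iff (hg : IsWeightedGraph g) (hgt : IsWeightedGraph gt)
    (hβ : 0 ≤ β) (hσ : 0 < σ) (μ : StateSpace n) {q : OrthonormalBasis (Fin n) ℝ (StateSpace n)}
    {ω : Fin n → ℝ} (hq : IsEigenbasis (payoffMatrix β g gt) q ω)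
    (hρ : ρ ∈ admissibleCorrelations n σ) {M : Type u} [MeasurableSpace M]
    (φ : Kernel (StateSpace n) M) [IsMarkovKernel φ] :
    IsOptimalSignal.{u, v} β g gt (stateLaw μ σ ρ) φ ↔ SortsByWeight (stateLaw μ σ ρ) φ q ω := by
  refine isOptimalSignal_iff_sortsByWeight hg hgt hβ IsGaussian.memLp_two_id hq
    -- `ULift` places the benchmark signal among the competitors in universe `v`.
    (sortsByWeight_deterministic hρ.2.posSemidef (M := ULift.{v} ({j : Fin n // 0 ≤ ω j} → ℝ))
      (w := fun j : {j : Fin n // 0 ≤ ω j} => q j) MeasurableEquiv.ulift.symm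
      (fun j hj => Submodule.subset_span ⟨⟨j, hj.le⟩, rfl⟩) fun j hj i => ?_)
  rw [dotProduct_equicorrelation_eq_zero_iff hσ hρ
    (hg.sum_eq_zero_of_eigenvalue_neg hgt hβ (hq j) hj)]
  exact q.orthonormal.2 fun hji => (hj.trans_le i.2).ne (congrArg ω hji)

theorem isOptimalSignal_linearSignal_iff (hg : IsWeightedGraph g) (hgt : IsWeightedGraph gt)
    (hβ : 0 ≤ β) (hσ : 0 < σ) (μ : StateSpace n) {q : OrthonormalBasis (Fin n) ℝ (StateSpace n)}
    {ω : Fin n → ℝ} (hq : IsEigenbasis (payoffMatrix β g gt) q ω)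
    (hρ : ρ ∈ admissibleCorrelations n σ) {ι : Type} [Finite ι] (w : ι → StateSpace n) :
    IsOptimalSignal.{0, v} β g gt (stateLaw μ σ ρ) (linearSignal w) ↔
      ∀ j, (0 < ω j → q j ∈ Submodule.span ℝ (Set.range w)) ∧
        (ω j < 0 → ∀ i, ⟪q j, w i⟫ = 0) := by
  rw [isOptimalSignal_stateLaw_iff hg hgt hβ hσ μ hq hρ, sortsByWeight_linearSignal_iff hρ.2]
  refine forall_congr' fun j => and_congr_right fun _ => forall_congr' fun hj =>
    forall_congr' fun i => ?_
  exact dotProduct_equicorrelation_eq_zero_iff hσ hρ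
    (hg.sum_eq_zero_of_eigenvalue_neg hgt hβ (hq j) hj) (w i)

end Optimality

theorem proposition12 (n : ℕ) [NeZero n] (g gt : Matrix (Fin n) (Fin n) ℝ)
    (hg : IsWeightedGraph g) (hgt : IsWeightedGraph gt) (β : ℝ) (hβ : 0 ≤ β)
    (σ : ℝ) (hσ : 0 < σ) (μ : StateSpace n) :
    -- `V` has an orthonormal eigenbasis that contains a multiple of the vector of ones
    (∃ (q : OrthonormalBasis (Fin n) ℝ (StateSpace n)) (ω : Fin n → ℝ),
      IsEigenbasis (payoffMatrix β g gt) q ω ∧ ∃ c : ℝ, (q 0).ofLp = fun _ => c) ∧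
    -- eigenvectors of `V` are eigenvectors of `Σ^{1/2} V Σ^{1/2}`, the signs being preserved
    (∀ ρ ∈ admissibleCorrelations n σ, ∀ (q : Fin n → ℝ) (ω : ℝ), q ≠ 0 →
      payoffMatrix β g gt *ᵥ q = ω • q →
      (ω ≠ 1 ∨ (∃ c : ℝ, q = fun _ => c) ∨ ∑ i, q i = 0) →
      ∃ τ : ℝ, transformedMatrix (equicorrelation n σ ρ) (payoffMatrix β g gt) *ᵥ q = τ • q ∧
        SignType.sign τ = SignType.sign ω) ∧
    -- one and the same signal, built from `V` alone, is optimal for every `ρ`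
    (∀ (q : OrthonormalBasis (Fin n) ℝ (StateSpace n)) (ω : Fin n → ℝ),
      IsEigenbasis (payoffMatrix β g gt) q ω →
      ∀ ρ ∈ admissibleCorrelations n σ,
        IsOptimalSignal.{0, v} β g gt (stateLaw μ σ ρ)
          (linearSignal fun j : {j : Fin n // 0 ≤ ω j} => q j)) ∧
    -- the signal `Z₊' Σ^{-1/2} x` is optimal and conveys the same information for every `ρ`
    (∀ (q : OrthonormalBasis (Fin n) ℝ (StateSpace n)) (ω : Fin n → ℝ),
      IsEigenbasis (payoffMatrix β g gt) q ω →
      ∀ ρ ∈ admissibleCorrelations n σ,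
      ∀ (z : OrthonormalBasis (Fin n) ℝ (StateSpace n)) (τ : Fin n → ℝ),
        IsEigenbasis (transformedMatrix (equicorrelation n σ ρ) (payoffMatrix β g gt)) z τ →
        IsOptimalSignal.{0, v} β g gt (stateLaw μ σ ρ)
            (linearSignal fun j : {j : Fin n // 0 ≤ τ j} =>
              whitened (equicorrelation n σ ρ) z j) ∧
          information (fun j : {j : Fin n // 0 ≤ τ j} => whitened (equicorrelation n σ ρ) z j) =
            information (fun j : {j : Fin n // 0 ≤ ω j} => q j)) ∧
    -- a list of linear statistics that is optimal for one `ρ` is optimal for every `ρ`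
    (∀ (k : ℕ) (w : Fin k → StateSpace n),
      ∀ ρ ∈ admissibleCorrelations n σ, ∀ ρ' ∈ admissibleCorrelations n σ,
        (IsOptimalSignal.{0, v} β g gt (stateLaw μ σ ρ) (linearSignal w) ↔
          IsOptimalSignal.{0, v} β g gt (stateLaw μ σ ρ') (linearSignal w))) ∧
    -- which of the statistics `qⱼ' x` an arbitrary optimal signal reveals does not depend on `ρ`
    (∀ (q : OrthonormalBasis (Fin n) ℝ (StateSpace n)) (ω : Fin n → ℝ),
      IsEigenbasis (payoffMatrix β g gt) q ω →
      ∀ ρ ∈ admissibleCorrelations n σ,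
      ∀ (M : Type u) [MeasurableSpace M] (φ : Kernel (StateSpace n) M) [IsMarkovKernel φ],
        IsOptimalSignal.{u, v} β g gt (stateLaw μ σ ρ) φ →
        ∀ j, ω j ≠ 0 →
          (Informs (stateLaw μ σ ρ) φ (fun x => ⟪q j, x⟫) ↔ 0 < ω j)) := by
  have hV := payoffMatrix_isSymm hg.symm hgt.symm β
  have hV1 := hg.payoffMatrix_mulVec_const (gt := gt) hβ 1
  have hbasis := exists_eigenbasis_const hV hV1
  have hpos : ∀ (q : OrthonormalBasis (Fin n) ℝ (StateSpace n)) (ω : Fin n → ℝ),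
      IsEigenbasis (payoffMatrix β g gt) q ω → ∀ ρ ∈ admissibleCorrelations n σ,
        IsOptimalSignal.{0, v} β g gt (stateLaw μ σ ρ)
          (linearSignal fun j : {j : Fin n // 0 ≤ ω j} => q j) := by
    intro q ω hq ρ hρ
    refine (isOptimalSignal_linearSignal_iff hg hgt hβ hσ μ hq hρ _).2 fun j =>
      ⟨fun hj => Submodule.subset_span ⟨⟨j, hj.le⟩, rfl⟩, fun hj i => q.orthonormal.2 ?_⟩
    rintro rfl
    exact hj.not_ge i.2
  refine ⟨hbasis, fun ρ hρ q ω hq0 hq h => transformedMatrix_mulVec_sign hV hV1 hρ hq0 hq h, hpos,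
    fun q ω hq ρ hρ z τ hz => ?_, fun k w ρ hρ ρ' hρ' => ?_,
    fun q ω hq ρ hρ M _ φ _ hφ j hj => ?_⟩
  · have hspan := span_whitened_eq hV hV1 hσ hρ hq hz
    refine ⟨(isOptimalSignal_linearSignal_iff hg hgt hβ hσ μ hq hρ _).2 fun j =>
      ⟨fun hj => ?_, fun hj i => ?_⟩, le_antisymm ?_ ?_⟩
    · rw [hspan]
      exact Submodule.subset_span ⟨⟨j, hj.le⟩, rfl⟩
    · have hmem : whitened (equicorrelation n σ ρ) z i ∈
          Submodule.span ℝ (Set.range fun j : {j : Fin n // 0 ≤ ω j} => q j) :=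
        hspan ▸ Submodule.subset_span ⟨i, rfl⟩
      have hle : Submodule.span ℝ (Set.range fun j : {j : Fin n // 0 ≤ ω j} => q j) ≤
          (ℝ ∙ q j)ᗮ := by
        rw [Submodule.span_le]
        rintro _ ⟨k, rfl⟩
        refine Submodule.mem_orthogonal_singleton_iff_inner_right.2 (q.orthonormal.2 ?_)
        rintro rfl
        exact hj.not_ge k.2
      exact Submodule.mem_orthogonal_singleton_iff_inner_right.1 (hle hmem)
    · exact information_le_of_mem_span fun i => hspan ▸ Submodule.subset_span ⟨i, rfl⟩
    · exact information_le_of_mem_span fun i => hspan ▸ Submodule.subset_span ⟨i, rfl⟩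
  -- Any eigenbasis of `V` serves: its criterion is the same for `ρ` and `ρ'`.
  · obtain ⟨q, ω, hq, -⟩ := hbasis
    rw [isOptimalSignal_linearSignal_iff hg hgt hβ hσ μ hq hρ,
      isOptimalSignal_linearSignal_iff hg hgt hβ hσ μ hq hρ']
  · have hsort := (isOptimalSignal_stateLaw_iff hg hgt hβ hσ μ hq hρ φ).1 hφ j
    refine ⟨fun hinf => lt_of_le_of_ne (not_lt.1 fun hneg => ?_) hj.symm, hsort.1⟩
    -- If `ω j < 0`, the statistic is both revealed and left at its prior mean, so its variance is
    -- zero, which forces `q j = 0`.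
    have hcov := covariance_eq_zero_of_informs (memLp_inner IsGaussian.memLp_two_id (q j))
      (by fun_prop) (memLp_inner IsGaussian.memLp_two_id (q j)) hinf (hsort.2 hneg)
    rw [covariance_inner_multivariateGaussian hρ.2.posSemidef,
      dotProduct_equicorrelation_eq_zero_iff hσ hρ
        (hg.sum_eq_zero_of_eigenvalue_neg hgt hβ (hq j) hneg), inner_self_eq_zero] at hcov
    exact q.orthonormal.ne_zero j hcov
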